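/- A *message set* over peers $\{1,\dots,n\}$, $n\ge 1$, is a finite set $\Sigma$ of letters, each letter $a$ having a sender and a receiver in $\{1,\dots,n\}$ that are distinct. Actions are $!a$ (executed by the sender of $a$) and $?a$ (executed by its receiver); a trace is a finite sequence of actions. A *system* $\mathcal S$ consists of one (not necessarily deterministic) finite automaton for each peer $i$, labelled by actions of peer $i$, with an initial state and with all states accepting. A configuration consists of a state for each peer and a word over $\Sigma$ for each channel $i\to j$, $i\ne j$; initially all peers are in their initial states and all channels are empty. If $a$ has sender $i$ and receiver $j$, the action $!a$ takes a transition of peer $i$ labelled $!a$ and appends $a$ to the channel $i\to j$, and $?a$ takes a transition of peer $j$ labelled $?a$ and removes $a$ from the front of the channel $i\to j$. A configuration is *stable* if all channels are empty. A trace of $\mathcal S$ is a trace that labels an execution from the initial configuration. For $k\ge 1$ let $T_k(\mathcal S)$ be the set of traces of $\mathcal S$ along which every channel always contains at most $k$ messages, let $T_0(\mathcal S)$ be the set of *synchronous* traces of $\mathcal S$, i.e. those of the form $!a_1?a_1!a_2?a_2\cdots !a_m?a_m$ with $m\ge 0$, and let $T_\omega(\mathcal S)=\bigcup_{k\ge 0}T_k(\mathcal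 S)$. The send trace of a trace is the sequence of the letters that it sends. For $k\in\mathbb N\cup\{\omega\}$ let $J_k(\mathcal S)$ be the set of send traces of the elements of $T_k(\mathcal S)$, and let $I_k(\mathcal S)$ be $J_k(\mathcal S)$ together with all pairs $(w,c)$ such that $c$ is a stable configuration reached from the initial configuration by some trace in $T_k(\mathcal S)$ with send trace $w$. The system $\mathcal S$ is *synchronizable* if $I_0(\mathcal S)=I_\omega(\mathcal S)$, and *language synchronizable* if $J_0(\mathcal S)=J_\omega(\mathcal S)$. **Theorem.** It is undecidable whether a given system (presented by finite lists of its letters, states and transitions) is synchronizable, and it is undecidable whether it is language synchronizable. Both problems are already undecidable for systems with exactly three peers: there is no algorithm that decides synchronizability correctly on all systems with three peers, and none that decides language synchronizability correctly on all of these. -/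

import Mathlib

/-!
Systems of communicating finite-state machines with one FIFO channel per ordered pair of peers,
their synchronous, bounded and unbounded traces, (language) synchronizability, and finite
presentations of such systems as inputs of algorithms.
-/

namespace CFSM

/-- A message set over the peers `Fin n`: a finite set of letters, each with a sender and a
different receiver. -/
structure MessageSet (n : ℕ) (L : Type) where
  finite : Finite L
  src : L → Fin n
  dst : L → Fin n
  src_ne_dst : ∀ a, src a ≠ dst a

/-- `send a` is the action `!a`, `recv a` is the action `?a`. -/
inductive Action (L : Type) where
  | send (a : L) : Action L
  | recv (a : L) : Action L

namespace Action

variable {L L' : Type}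

def map (f : L → L') : Action L → Action L'
  | send a => send (f a)
  | recv a => recv (f a)

/-- The letter of a send action. -/
def sent : Action L → Option L
  | send a => some a
  | recv _ => none

/-- The letter of a receive action. -/
def received : Action L → Option L
  | send _ => none
  | recv a => some a

def letter : Action L → L
  | send a => a
  | recv a => a

end Action

abbrev Trace (L : Type) := List (Action L)

namespace Trace

variable {L : Type}

/-- The sequence of messages sent during a trace. -/
def sendProj (τ : Trace L) : List L := τ.filterMap Action.sent

/-- The sequence of messages received during a trace. -/
def recvProj (τ : Trace L) : List L := τ.filterMap Action.received

/-- A trace of the form `!a₁ ?a₁ !a₂ ?a₂ ⋯ !aₖ ?aₖ` with `k ≥ 0`. -/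
def IsSynchronous (τ : Trace L) : Prop :=
  ∃ w : List L, τ = w.flatMap fun a => [Action.send a, Action.recv a]

end Trace

namespace MessageSet

variable {n : ℕ} {L : Type} (M : MessageSet n L)

/-- The peer that executes an action. -/
def peer : Action L → Fin n
  | Action.send a => M.src a
  | Action.recv a => M.dst a

/-- The actions of a trace that act on the channel from `i` to `j`. -/
def chanProj (i j : Fin n) (τ : Trace L) : Trace L :=
  τ.filter fun α => M.src α.letter = i ∧ M.dst α.letter = j

/-- `w` is the content of the channel from `i` to `j` after `τ`. -/
def IsBuffer (i j : Fin n) (τ : Trace L) (w : List L) : Prop :=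
  (M.chanProj i j τ).sendProj = (M.chanProj i j τ).recvProj ++ w

/-- `k`-bounded FIFO traces. -/
def IsBoundedFIFO (k : ℕ) (τ : Trace L) : Prop :=
  ∀ i j : Fin n, ∀ τ' : Trace L, τ' <+: τ → ∃ w, M.IsBuffer i j τ' w ∧ w.length ≤ k

end MessageSet

/-- A system over `M`: one finite automaton for each peer, over the actions of this peer; all
states are accepting. -/
structure System {n : ℕ} {L : Type} (M : MessageSet n L) where
  State : Fin n → Type
  finite : ∀ i, Finite (State i)
  init : ∀ i, State i
  trans : ∀ i, State i → Action L → State i → Prop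
  peer_eq : ∀ i q α q', trans i q α q' → M.peer α = i

namespace System

variable {n : ℕ} {L : Type} {M : MessageSet n L} (S : System M)

/-- A state for each peer and a content for each channel. No letter has the same sender and
receiver, so the entries `chan i i` are never used: they are empty in every reachable
configuration. -/
structure Config where
  state : ∀ i, S.State i
  chan : Fin n → Fin n → List L

def initConfig : S.Config where
  state := S.init
  chan := fun _ _ => []

variable {S} in
/-- All channels between two different peers are empty. -/
def Config.IsStable (c : S.Config) : Prop := ∀ i j, i ≠ j → c.chan i j = []

/-- One transition of the system. -/
def Step (c : S.Config) : Action L → S.Config → Prop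
  | Action.send a, c' =>
      S.trans (M.src a) (c.state (M.src a)) (Action.send a) (c'.state (M.src a)) ∧
      c'.chan (M.src a) (M.dst a) = c.chan (M.src a) (M.dst a) ++ [a] ∧
      (∀ k, k ≠ M.src a → c'.state k = c.state k) ∧
      (∀ k l, ¬ (k = M.src a ∧ l = M.dst a) → c'.chan k l = c.chan k l)
  | Action.recv a, c' =>
      S.trans (M.dst a) (c.state (M.dst a)) (Action.recv a) (c'.state (M.dst a)) ∧
      c.chan (M.src a) (M.dst a) = a :: c'.chan (M.src a) (M.dst a) ∧
      (∀ k, k ≠ M.dst a → c'.state k = c.state k) ∧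
      (∀ k l, ¬ (k = M.src a ∧ l = M.dst a) → c'.chan k l = c.chan k l)

/-- `S.Run c τ c'`: the trace `τ` leads from `c` to `c'`. -/
def Run : S.Config → Trace L → S.Config → Prop
  | c, [], c' => c = c'
  | c, α :: τ, c' => ∃ d, S.Step c α d ∧ Run d τ c'

/-- `τ` is a trace of the system. -/
def IsTrace (τ : Trace L) : Prop := ∃ c, S.Run S.initConfig τ c

/-- The synchronous traces of the system for `k = 0`, its `k`-bounded traces for `k ≥ 1`. -/
def traces : ℕ → Set (Trace L)
  | 0 => {τ | S.IsTrace τ ∧ τ.IsSynchronous}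
  | k + 1 => {τ | S.IsTrace τ ∧ M.IsBoundedFIFO (k + 1) τ}

def tracesOmega : Set (Trace L) := ⋃ k, S.traces k

/-- The send traces of the traces in `T`. -/
def sendTraces (T : Set (Trace L)) : Set (List L) := Trace.sendProj '' T

/-- The send traces of the traces in `T`, together with the pairs of a send trace and a stable
configuration in which such a trace may end (a disjoint union). -/
def observations (T : Set (Trace L)) : Set (List L ⊕ List L × S.Config) :=
  Sum.inl '' sendTraces T ∪
    Sum.inr '' {x | ∃ τ ∈ T, S.Run S.initConfig τ x.2 ∧ x.2.IsStable ∧ x.1 = τ.sendProj}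

def Synchronizable : Prop := S.observations (S.traces 0) = S.observations S.tracesOmega

def LanguageSynchronizable : Prop := sendTraces (S.traces 0) = sendTraces S.tracesOmega

end System

/-! ### Finite presentations of systems -/

/-- A presentation of a finite automaton with states `0, …, numStates - 1`; letters are natural
numbers, and a transition is a triple (state, action, state). -/
structure PeerCode where
  numStates : ℕ
  init : ℕ
  trans : List (ℕ × Action ℕ × ℕ)

/-- A presentation of a system. The letters are `0, …, messages.length - 1`, letter `a` has
the sender and receiver given by `messages[a]`; the peers are `0, …, peers.length - 1`. -/
structure SystemCode where
  messages : List (ℕ × ℕ)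
  peers : List PeerCode

def Action.equivSum (L : Type) : Action L ≃ L ⊕ L where
  toFun
    | Action.send a => Sum.inl a
    | Action.recv a => Sum.inr a
  invFun
    | Sum.inl a => Action.send a
    | Sum.inr a => Action.recv a
  left_inv := by rintro (_ | _) <;> rfl
  right_inv := by rintro (_ | _) <;> rfl

instance Action.instPrimcodable {L : Type} [Primcodable L] : Primcodable (Action L) :=
  Primcodable.ofEquiv (L ⊕ L) (Action.equivSum L)

def PeerCode.equivProd : PeerCode ≃ ℕ × ℕ × List (ℕ × Action ℕ × ℕ) where
  toFun p := (p.numStates, p.init, p.trans)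
  invFun x := ⟨x.1, x.2.1, x.2.2⟩
  left_inv _ := rfl
  right_inv _ := rfl

instance PeerCode.instPrimcodable : Primcodable PeerCode :=
  Primcodable.ofEquiv _ PeerCode.equivProd

def SystemCode.equivProd : SystemCode ≃ List (ℕ × ℕ) × List PeerCode where
  toFun c := (c.messages, c.peers)
  invFun x := ⟨x.1, x.2⟩
  left_inv _ := rfl
  right_inv _ := rfl

instance SystemCode.instPrimcodable : Primcodable SystemCode :=
  Primcodable.ofEquiv _ SystemCode.equivProd

namespace SystemCode

variable (c : SystemCode)

def numPeers : ℕ := c.peers.length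

/-- The peer that executes an action, if its letter exists. -/
def peer? : Action ℕ → Option ℕ
  | Action.send a => c.messages[a]?.map Prod.fst
  | Action.recv a => c.messages[a]?.map Prod.snd

/-- The presentation describes a system with at least one peer: senders and receivers are
distinct existing peers, initial states and the states of transitions exist, and the transitions
of each peer are labelled by actions of this peer. -/
structure WellFormed : Prop where
  one_le : 1 ≤ c.numPeers
  messages_ok : ∀ m ∈ c.messages, m.1 < c.numPeers ∧ m.2 < c.numPeers ∧ m.1 ≠ m.2
  init_ok : ∀ p ∈ c.peers, p.init < p.numStates
  trans_ok : ∀ (i : ℕ) (hi : i < c.peers.length), ∀ t ∈ c.peers[i].trans,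
    t.1 < c.peers[i].numStates ∧ t.2.2 < c.peers[i].numStates ∧ c.peer? t.2.1 = some i

variable {c}

/-- The message set described by a well-formed presentation. -/
def messageSet (h : c.WellFormed) : MessageSet c.numPeers (Fin c.messages.length) where
  finite := inferInstance
  src a := ⟨c.messages[a].1, (h.messages_ok _ (List.getElem_mem _)).1⟩
  dst a := ⟨c.messages[a].2, (h.messages_ok _ (List.getElem_mem _)).2.1⟩
  src_ne_dst a e := (h.messages_ok _ (List.getElem_mem a.isLt)).2.2 (congrArg Fin.val e)

/-- The system described by a well-formed presentation. -/
def toSystem (h : c.WellFormed) : System (messageSet h) where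
  State i := Fin (c.peers[i.val]'i.isLt).numStates
  finite _ := inferInstance
  init i := ⟨(c.peers[i.val]'i.isLt).init, h.init_ok _ (List.getElem_mem _)⟩
  trans i q α q' := (q.val, α.map Fin.val, q'.val) ∈ (c.peers[i.val]'i.isLt).trans
  peer_eq i q α q' ht := by
    have h1 := (h.trans_ok i.val i.isLt _ ht).2.2
    cases α <;> simpa [peer?, Action.map, MessageSet.peer, messageSet, Fin.ext_iff] using h1

end SystemCode

end CFSM

/-!
The halting problem is reduced to both problems at once: from a program one computes a system with
three peers that is not language synchronizable if the program halts and synchronizable if it does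
not. As synchronizability implies language synchronizability, this suffices.

*The three peers.* A `Controller` executes a queue automaton, and the queue is the channel to a
`Checker`, from which letters are removed by guessing: to dequeue `a` the controller orders the
checker to remove `a`, through a forwarder, so that the order does not queue behind the letters, and
waits for an acknowledgement. An honest checker that has received the order to remove `a` receives
`a` from the queue, if it is there, and then either acknowledges or, if `a` is a special letter `s`,
may raise an alarm instead. But the checker may become sloppy: it then receives letters of the queue
at any time and acknowledges every order.

In a synchronous run the queue is always empty when an order is given, so the order can only be
acknowledged by a sloppy checker, and the alarm is never raised. If the queue automaton can dequeue
`s`, then the alarm is raised in some asynchronous run, and the system is not language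
synchronizable (`Controller.hasAsyncSend`). If it cannot, then every run has a synchronous
counterpart with the same send trace, in which the checker is sloppy from the first message on,
since a sloppy checker can send whatever an honest one sends, except for the alarm, which is never
raised in this case (`Controller.hasSyncRuns`). The two runs end in the same stable configuration:
the only possible difference is that the checker might be honest in the first run although messages
have been exchanged; but then the channel from the controller is the queue of the automaton, which
never gets empty if there are always two letters in it when one is dequeued.

*The queue automaton.* A machine with finitely many stacks (`TM2`) is simulated by storing its
stacks one after the other in the queue, each preceded by a mark, and turning the queue; when the
machine halts, the letter `halted` is enqueued (`QueueSim.Rule`). The marks keep the queue long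
enough, and `halted` can be dequeued if and only if the machine halts
(`QueueSim.finController_dequeues_iff`).

*The reduction.* The machine is a fixed one that runs a given program, by Mathlib's translation of
partial recursive functions to such machines. Only the initial queue depends on the program. In the
presentation of the system it affects nothing but a chain of transitions that enqueue it, and this
chain is computable (`QueueSim.exists_presents_finController`, `exists_reduction`).
-/

namespace CFSM

/-! ### Runs, channel contents and criteria for synchronizability -/

/-- The synchronous trace `!a₁ ?a₁ ⋯ !aₘ ?aₘ` of a word `a₁ ⋯ aₘ`. -/
def syncTrace {L : Type} (w : List L) : Trace L :=
  w.flatMap fun a => [Action.send a, Action.recv a]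

namespace Trace

variable {L : Type} (a : L) (τ : Trace L)

@[simp] lemma sendProj_nil : sendProj ([] : Trace L) = [] := rfl

@[simp] lemma sendProj_send_cons : sendProj (Action.send a :: τ) = a :: sendProj τ := rfl

@[simp] lemma sendProj_recv_cons : sendProj (Action.recv a :: τ) = sendProj τ := rfl

@[simp] lemma recvProj_send_cons : recvProj (Action.send a :: τ) = recvProj τ := rfl

@[simp] lemma recvProj_recv_cons : recvProj (Action.recv a :: τ) = a :: recvProj τ := rfl

lemma sendProj_append (σ τ : Trace L) : sendProj (σ ++ τ) = sendProj σ ++ sendProj τ :=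
  List.filterMap_append ..

end Trace

@[simp] lemma sendProj_syncTrace {L : Type} (w : List L) : (syncTrace w).sendProj = w := by
  induction w with
  | nil => rfl
  | cons a w ih => exact congrArg (a :: ·) ih

lemma syncTrace_append {L : Type} (v w : List L) :
    syncTrace (v ++ w) = syncTrace v ++ syncTrace w := by
  simp [syncTrace]

namespace System

variable {n : ℕ} {L : Type} {M : MessageSet n L} (S : System M)

variable {S} in
lemma config_ext {c c' : S.Config} (hs : ∀ k, c.state k = c'.state k)
    (hc : ∀ k l, c.chan k l = c'.chan k l) : c = c' := by
  obtain ⟨s, h⟩ := c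
  obtain ⟨s', h'⟩ := c'
  obtain rfl : s = s' := funext hs
  obtain rfl : h = h' := funext fun k => funext (hc k)
  rfl

/-- Sending `a` is determined by the next state of the sender, if `e q` denotes the resulting
configuration for the next state `q`. -/
lemma step_send_iff {c c' : S.Config} {a : L} (e : S.State (M.src a) → S.Config)
    (he : ∀ q, (e q).state (M.src a) = q ∧
      (e q).chan (M.src a) (M.dst a) = c.chan (M.src a) (M.dst a) ++ [a] ∧
      (∀ k, k ≠ M.src a → (e q).state k = c.state k) ∧
      ∀ k l, ¬ (k = M.src a ∧ l = M.dst a) → (e q).chan k l = c.chan k l) :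
    S.Step c (.send a) c' ↔
      ∃ q, S.trans (M.src a) (c.state (M.src a)) (.send a) q ∧ c' = e q := by
  constructor
  · rintro ⟨h1, h2, h3, h4⟩
    refine ⟨_, h1, ?_⟩
    obtain ⟨g1, g2, g3, g4⟩ := he (c'.state (M.src a))
    refine config_ext (fun k => ?_) (fun k l => ?_)
    · by_cases hk : k = M.src a
      · subst hk; exact g1.symm
      · rw [h3 k hk, g3 k hk]
    · by_cases hk : k = M.src a ∧ l = M.dst a
      · obtain ⟨rfl, rfl⟩ := hk
        rw [h2, g2]
      · rw [h4 k l hk, g4 k l hk]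
  · rintro ⟨q, hq, rfl⟩
    obtain ⟨g1, g2, g3, g4⟩ := he q
    exact ⟨g1.symm ▸ hq, g2, g3, g4⟩

/-- Receiving `a` is determined by the next state of the receiver and what is left in the
channel, if `e q w` denotes the resulting configuration for the next state `q` and the remaining
content `w`. -/
lemma step_recv_iff {c c' : S.Config} {a : L} (e : S.State (M.dst a) → List L → S.Config)
    (he : ∀ q w, (e q w).state (M.dst a) = q ∧ (e q w).chan (M.src a) (M.dst a) = w ∧
      (∀ k, k ≠ M.dst a → (e q w).state k = c.state k) ∧
      ∀ k l, ¬ (k = M.src a ∧ l = M.dst a) → (e q w).chan k l = c.chan k l) :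
    S.Step c (.recv a) c' ↔ ∃ q w, S.trans (M.dst a) (c.state (M.dst a)) (.recv a) q ∧
      c.chan (M.src a) (M.dst a) = a :: w ∧ c' = e q w := by
  constructor
  · rintro ⟨h1, h2, h3, h4⟩
    refine ⟨_, _, h1, h2, ?_⟩
    obtain ⟨g1, g2, g3, g4⟩ := he (c'.state (M.dst a)) (c'.chan (M.src a) (M.dst a))
    refine config_ext (fun k => ?_) (fun k l => ?_)
    · by_cases hk : k = M.dst a
      · subst hk; exact g1.symm
      · rw [h3 k hk, g3 k hk]
    · by_cases hk : k = M.src a ∧ l = M.dst a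
      · obtain ⟨rfl, rfl⟩ := hk
        exact g2.symm
      · rw [h4 k l hk, g4 k l hk]
  · rintro ⟨q, w, hq, hw, rfl⟩
    obtain ⟨g1, g2, g3, g4⟩ := he q w
    exact ⟨g1.symm ▸ hq, g2.symm ▸ hw, g3, g4⟩

lemma run_append {c c' : S.Config} {σ τ : Trace L} :
    S.Run c (σ ++ τ) c' ↔ ∃ d, S.Run c σ d ∧ S.Run d τ c' := by
  induction σ generalizing c with
  | nil => simp [Run]
  | cons α σ ih =>
    simp only [List.cons_append, Run, ih]
    constructor
    · rintro ⟨d, h1, e, h2, h3⟩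
      exact ⟨e, ⟨d, h1, h2⟩, h3⟩
    · rintro ⟨e, ⟨d, h1, h2⟩, h3⟩
      exact ⟨d, h1, e, h2, h3⟩

lemma run_snoc {c c' : S.Config} {τ : Trace L} {α : Action L} :
    S.Run c (τ ++ [α]) c' ↔ ∃ d, S.Run c τ d ∧ S.Step d α c' := by
  simp [run_append, Run]

/-- Along a run, what was in a channel together with what was sent to it is what was received
from it together with what is left in it. -/
lemma chan_append_sendProj {c c' : S.Config} {τ : Trace L} (h : S.Run c τ c') (i j : Fin n) :
    c.chan i j ++ (M.chanProj i j τ).sendProj = (M.chanProj i j τ).recvProj ++ c'.chan i j := by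
  induction τ generalizing c with
  | nil =>
    cases h
    simp [MessageSet.chanProj, Trace.sendProj, Trace.recvProj]
  | cons α τ ih =>
    obtain ⟨d, h1, h2⟩ := h
    have := ih h2
    cases α with
    | send a =>
      obtain ⟨-, h3, -, h4⟩ := h1
      by_cases hij : M.src a = i ∧ M.dst a = j
      · obtain ⟨rfl, rfl⟩ := hij
        rw [h3] at this
        simpa [MessageSet.chanProj, Action.letter] using this
      · rw [h4 i j (fun e => hij ⟨e.1.symm, e.2.symm⟩)] at this
        simpa [MessageSet.chanProj, Action.letter, hij] using this
    | recv a =>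
      obtain ⟨-, h3, -, h4⟩ := h1
      by_cases hij : M.src a = i ∧ M.dst a = j
      · obtain ⟨rfl, rfl⟩ := hij
        rw [h3]
        simpa [MessageSet.chanProj, Action.letter] using this
      · rw [h4 i j (fun e => hij ⟨e.1.symm, e.2.symm⟩)] at this
        simpa [MessageSet.chanProj, Action.letter, hij] using this

lemma IsTrace.isBoundedFIFO {τ : Trace L} (h : S.IsTrace τ) {k : ℕ} (hk : τ.length ≤ k) :
    M.IsBoundedFIFO k τ := by
  rintro i j τ' ⟨σ, rfl⟩
  obtain ⟨c, hc⟩ := h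
  obtain ⟨d, hd, -⟩ := (S.run_append).1 hc
  have hb := S.chan_append_sendProj hd i j
  refine ⟨d.chan i j, by simpa [MessageSet.IsBuffer, initConfig] using hb, ?_⟩
  have h1 : ((M.chanProj i j τ').sendProj).length ≤ τ'.length :=
    (List.length_filterMap_le ..).trans (List.length_filter_le ..)
  have h2 := congrArg List.length hb
  simp only [initConfig, List.nil_append, List.length_append] at h1 h2 hk
  omega

/-- A trace is bounded by its length, so `T_ω` consists of all traces. -/
lemma tracesOmega_eq : S.tracesOmega = {τ | S.IsTrace τ} := by
  ext τ
  simp only [tracesOmega, Set.mem_iUnion, Set.mem_ofPred_eq]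
  constructor
  · rintro ⟨_ | k, h⟩ <;> exact h.1
  · intro h
    exact ⟨τ.length + 1, h, IsTrace.isBoundedFIFO S h (Nat.le_succ _)⟩

lemma traces_zero_eq : S.traces 0 = {τ | S.IsTrace τ ∧ ∃ w, τ = syncTrace w} := rfl

/-- Every run can be replaced by a synchronous run with the same send trace, which leads to the
same configuration if that configuration is stable. -/
def HasSyncRuns : Prop :=
  ∀ τ c, S.Run S.initConfig τ c →
    ∃ c', S.Run S.initConfig (syncTrace τ.sendProj) c' ∧ (c.IsStable → c' = c)

/-- Some message is sent during a run but during no synchronous run. -/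
def HasAsyncSend : Prop :=
  ∃ a τ c, S.Run S.initConfig τ c ∧ a ∈ τ.sendProj ∧
    ∀ w c', S.Run S.initConfig (syncTrace w) c' → a ∉ w

variable {S}

lemma HasSyncRuns.synchronizable (h : S.HasSyncRuns) : S.Synchronizable := by
  rw [Synchronizable, tracesOmega_eq, traces_zero_eq]
  refine Set.Subset.antisymm ?_ ?_
  · rintro x (⟨w, ⟨τ, hτ, rfl⟩, rfl⟩ | ⟨x, ⟨τ, hτ, hx⟩, rfl⟩)
    · exact Or.inl ⟨_, ⟨τ, hτ.1, rfl⟩, rfl⟩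
    · exact Or.inr ⟨_, ⟨τ, hτ.1, hx⟩, rfl⟩
  · rintro x (⟨w, ⟨τ, ⟨c, hc⟩, rfl⟩, rfl⟩ | ⟨⟨w, c⟩, ⟨τ, -, hc, hs, hw⟩, rfl⟩)
    · obtain ⟨c', hc', -⟩ := h τ c hc
      exact Or.inl ⟨_, ⟨_, ⟨⟨c', hc'⟩, _, rfl⟩, sendProj_syncTrace _⟩, rfl⟩
    · obtain ⟨c', hc', e⟩ := h τ c hc
      obtain rfl := e hs
      dsimp only at hw
      subst hw
      exact Or.inr ⟨_, ⟨_, ⟨⟨c', hc'⟩, _, rfl⟩, hc', hs, (sendProj_syncTrace _).symm⟩, rfl⟩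

lemma HasAsyncSend.not_languageSynchronizable (h : S.HasAsyncSend) :
    ¬ S.LanguageSynchronizable := by
  obtain ⟨a, τ, c, hc, ha, hn⟩ := h
  rw [LanguageSynchronizable, tracesOmega_eq, traces_zero_eq]
  intro e
  have : τ.sendProj ∈ sendTraces {τ | S.IsTrace τ} := ⟨τ, ⟨c, hc⟩, rfl⟩
  rw [← e] at this
  obtain ⟨σ, ⟨⟨c', hc'⟩, w, rfl⟩, hσ⟩ := this
  rw [sendProj_syncTrace] at hσ
  exact hn w c' hc' (hσ ▸ ha)

lemma Synchronizable.languageSynchronizable (h : S.Synchronizable) :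
    S.LanguageSynchronizable := by
  have key : ∀ T : Set (Trace L), sendTraces T = Sum.inl ⁻¹' S.observations T := by
    intro T
    ext w
    simp [observations]
  rw [LanguageSynchronizable, key, key, h]

/-! ### Isomorphic systems -/

/-- An isomorphism of systems over the same peers: a renaming of the letters and of the states. -/
structure Iso {L' : Type} {M' : MessageSet n L'} (S : System M) (S' : System M') where
  letter : L ≃ L'
  state : ∀ i, S.State i ≃ S'.State i
  src_eq : ∀ a, M'.src (letter a) = M.src a
  dst_eq : ∀ a, M'.dst (letter a) = M.dst a
  init_eq : ∀ i, S'.init i = state i (S.init i)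
  trans_iff : ∀ i q α q',
    S'.trans i (state i q) (α.map letter) (state i q') ↔ S.trans i q α q'

namespace Iso

variable {L' : Type} {M' : MessageSet n L'} {S' : System M'} (e : Iso S S')

/-- The bijection between configurations. -/
def config : S.Config ≃ S'.Config where
  toFun c := ⟨fun i => e.state i (c.state i), fun i j => (c.chan i j).map e.letter⟩
  invFun c := ⟨fun i => (e.state i).symm (c.state i), fun i j => (c.chan i j).map e.letter.symm⟩
  left_inv c := by simp
  right_inv c := by simp

lemma config_initConfig : e.config S.initConfig = S'.initConfig := by
  simp [config, initConfig, ← e.init_eq]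

lemma isStable_config {c : S.Config} : (e.config c).IsStable ↔ c.IsStable := by
  simp [Config.IsStable, config]

lemma step_config {c d : S.Config} {α : Action L} :
    S'.Step (e.config c) (α.map e.letter) (e.config d) ↔ S.Step c α d := by
  have hinj : Function.Injective (List.map e.letter) := List.map_injective_iff.2 e.letter.injective
  cases α with
  | send a =>
    have : S'.trans (M'.src (e.letter a)) ((e.config c).state (M'.src (e.letter a)))
        (Action.send (e.letter a)) ((e.config d).state (M'.src (e.letter a))) ↔
        S.trans (M.src a) (c.state (M.src a)) (Action.send a) (d.state (M.src a)) := by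
      rw [e.src_eq]
      exact e.trans_iff _ _ (Action.send a) _
    simp only [Step, Action.map, this]
    simp only [e.src_eq, e.dst_eq, config, Equiv.coe_fn_mk, EmbeddingLike.apply_eq_iff_eq,
      hinj.eq_iff]
    rw [← hinj.eq_iff (b := c.chan (M.src a) (M.dst a) ++ [a])]
    simp
  | recv a =>
    have : S'.trans (M'.dst (e.letter a)) ((e.config c).state (M'.dst (e.letter a)))
        (Action.recv (e.letter a)) ((e.config d).state (M'.dst (e.letter a))) ↔
        S.trans (M.dst a) (c.state (M.dst a)) (Action.recv a) (d.state (M.dst a)) := by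
      rw [e.dst_eq]
      exact e.trans_iff _ _ (Action.recv a) _
    simp only [Step, Action.map, this]
    simp only [e.src_eq, e.dst_eq, config, Equiv.coe_fn_mk, EmbeddingLike.apply_eq_iff_eq,
      hinj.eq_iff]
    rw [← hinj.eq_iff (a := c.chan (M.src a) (M.dst a))]
    simp

lemma run_config {c d : S.Config} {τ : Trace L} :
    S'.Run (e.config c) (τ.map (Action.map e.letter)) (e.config d) ↔ S.Run c τ d := by
  induction τ generalizing c with
  | nil => simp [Run]
  | cons α τ ih =>
    simp only [List.map_cons, Run, ← e.config.exists_congr_right (q := fun d' =>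
      S'.Step (e.config c) (α.map e.letter) d' ∧ S'.Run d' (τ.map (Action.map e.letter))
        (e.config d)), step_config, ih]

lemma sendProj_map (τ : Trace L) :
    Trace.sendProj (τ.map (Action.map e.letter)) = τ.sendProj.map e.letter := by
  induction τ with
  | nil => rfl
  | cons α τ ih =>
    cases α <;> simp [Action.map, ih]

lemma syncTrace_map (w : List L) :
    syncTrace (w.map e.letter) = (syncTrace w).map (Action.map e.letter) := by
  induction w with
  | nil => rfl
  | cons a w ih => simpa [syncTrace, Action.map] using ih

lemma exists_map_eq (τ : Trace L') : ∃ σ : Trace L, τ = σ.map (Action.map e.letter) := by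
  refine ⟨τ.map (Action.map e.letter.symm), ?_⟩
  rw [List.map_map]
  refine (List.map_id'' ?_ τ).symm
  rintro (_ | _) <;> simp [Action.map]

lemma hasSyncRuns (e : Iso S S') (h : S.HasSyncRuns) : S'.HasSyncRuns := by
  intro τ c hc
  obtain ⟨τ, rfl⟩ := e.exists_map_eq τ
  obtain ⟨c, rfl⟩ := e.config.surjective c
  rw [← e.config_initConfig, e.run_config] at hc
  obtain ⟨c', hc', hs⟩ := h τ c hc
  refine ⟨e.config c', ?_, fun h => by rw [hs (e.isStable_config.1 h)]⟩
  rwa [e.sendProj_map, e.syncTrace_map, ← e.config_initConfig, e.run_config]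

lemma hasAsyncSend (e : Iso S S') (h : S.HasAsyncSend) : S'.HasAsyncSend := by
  obtain ⟨a, τ, c, hc, ha, hn⟩ := h
  refine ⟨e.letter a, τ.map (Action.map e.letter), e.config c, ?_, ?_, fun w c' hc' hw => ?_⟩
  · rwa [← e.config_initConfig, e.run_config]
  · rw [e.sendProj_map]
    exact List.mem_map_of_mem ha
  · obtain ⟨c', rfl⟩ := e.config.surjective c'
    obtain ⟨w, rfl⟩ : ∃ v : List L, w = v.map e.letter := ⟨w.map e.letter.symm, by simp⟩
    rw [e.syncTrace_map, ← e.config_initConfig, e.run_config] at hc'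
    exact hn w c' hc' (by simpa using hw)

end Iso

end System

end CFSM

namespace CFSM

/-! ### Three peers simulating a queue automaton -/

/-- A queue automaton over the alphabet `Γ`, in the form in which one peer executes it:
`push x a y` enqueues `a`, and dequeuing `a` is done in two transitions, an `order` to dequeue
`a` and the transition `next` once the order is acknowledged. -/
structure Controller (Γ : Type) where
  State : Type
  init : State
  push : State → Γ → State → Prop
  order : State → Γ → State → Prop
  next : State → Γ → State → Prop

namespace Controller

variable {Γ : Type} (C : Controller Γ)

/-- The states from which the controller acts on the queue, with the contents of the queue, that
are reachable from the initial state and the empty queue. -/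
inductive Reaches : C.State → List Γ → Prop
  | init : Reaches C.init []
  | push {x a y u} : Reaches x u → C.push x a y → Reaches y (u ++ [a])
  | pop {x a z y u} : Reaches x (a :: u) → C.order x a z → C.next z a y → Reaches y u

/-- After an order the controller waits for its acknowledgement, and it has exactly one way to
go on. -/
def Waits : Prop :=
  ∀ x a z, C.order x a z → (∀ b y, ¬ C.push z b y) ∧ (∀ b y, ¬ C.order z b y) ∧
    ∃ y, ∀ b y', C.next z b y' ↔ b = a ∧ y' = y

/-- Some reachable dequeuing transition removes the letter `s`. -/
def Dequeues (s : Γ) : Prop := ∃ x u z, C.Reaches x (s :: u) ∧ C.order x s z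

/-- Whenever a dequeuing transition may be tried, the queue has at least two letters. -/
def KeepsTwo : Prop := ∀ x u a z, C.Reaches x u → C.order x a z → 2 ≤ u.length

end Controller

/-- The messages between the controller `0`, the checker `1` and the forwarder `2`: `data a` goes
from `0` to `1`, so that this channel is the queue; `order a` goes from `0` to `2` and is
forwarded as `relay a` to `1`; `ack a` and `alarm` go from `1` to `0`. -/
inductive Msg (Γ : Type) where
  | data (a : Γ)
  | order (a : Γ)
  | relay (a : Γ)
  | ack (a : Γ)
  | alarm

namespace Msg

variable {Γ : Type}

/-- Messages as elements of a finite type. -/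
def equivSum : Msg Γ ≃ (Γ ⊕ Γ) ⊕ (Γ ⊕ Γ) ⊕ Unit where
  toFun
    | data a => .inl (.inl a)
    | order a => .inl (.inr a)
    | relay a => .inr (.inl (.inl a))
    | ack a => .inr (.inl (.inr a))
    | alarm => .inr (.inr ())
  invFun
    | .inl (.inl a) => data a
    | .inl (.inr a) => order a
    | .inr (.inl (.inl a)) => relay a
    | .inr (.inl (.inr a)) => ack a
    | .inr (.inr ()) => alarm
  left_inv := by rintro (_ | _ | _ | _ | _) <;> rfl
  right_inv := by rintro ((_ | _) | (_ | _) | _) <;> rfl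

instance [Finite Γ] : Finite (Msg Γ) := Finite.of_equiv _ equivSum.symm

def src : Msg Γ → Fin 3
  | data _ => 0
  | order _ => 0
  | relay _ => 2
  | ack _ => 1
  | alarm => 1

def dst : Msg Γ → Fin 3
  | data _ => 1
  | order _ => 2
  | relay _ => 1
  | ack _ => 0
  | alarm => 0

/-- The message set of the three peers. -/
@[simps]
def messageSet (Γ : Type) [Finite Γ] : MessageSet 3 (Msg Γ) where
  finite := inferInstance
  src := src
  dst := dst
  src_ne_dst := by rintro (_ | _ | _ | _ | _) <;> simp [src, dst]

end Msg

/-- The states of the checker. As long as it is `honest` it has executed all orders by removing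
the ordered letter from the queue: it is `holding a` when it has received the order to remove `a`,
and `matched a` when it has removed `a`. Once it is `sloppy` it acknowledges orders without
looking at the queue, being `obeying a` in between. -/
inductive Checker (Γ : Type) where
  | honest
  | holding (a : Γ)
  | matched (a : Γ)
  | sloppy
  | obeying (a : Γ)

namespace Checker

variable {Γ : Type}

def equivSum : Checker Γ ≃ (Γ ⊕ Γ) ⊕ Γ ⊕ Bool where
  toFun
    | holding a => .inl (.inl a)
    | matched a => .inl (.inr a)
    | obeying a => .inr (.inl a)
    | honest => .inr (.inr true)
    | sloppy => .inr (.inr false)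
  invFun
    | .inl (.inl a) => holding a
    | .inl (.inr a) => matched a
    | .inr (.inl a) => obeying a
    | .inr (.inr true) => honest
    | .inr (.inr false) => sloppy
  left_inv := by rintro (_ | _ | _ | _ | _) <;> rfl
  right_inv := by rintro ((_ | _) | (_ | (_ | _))) <;> rfl

instance [Finite Γ] : Finite (Checker Γ) := Finite.of_equiv _ equivSum.symm

/-- The transitions of the checker. It starts as `honest` and may become `sloppy` at any time at
which it is not executing an order. It can raise the alarm when, still honest, it has removed the
letter `s`. -/
inductive Trans (s : Γ) : Checker Γ → Action (Msg Γ) → Checker Γ → Prop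
  | hold (a) : Trans s honest (.recv (.relay a)) (holding a)
  | check (a) : Trans s (holding a) (.recv (.data a)) (matched a)
  | report (a) : Trans s (matched a) (.send (.ack a)) honest
  | alarm : Trans s (matched s) (.send .alarm) honest
  | skip (a) : Trans s honest (.recv (.data a)) sloppy
  | yield (a) : Trans s honest (.recv (.relay a)) (obeying a)
  | ignore (a) : Trans s sloppy (.recv (.data a)) sloppy
  | obey (a) : Trans s sloppy (.recv (.relay a)) (obeying a)
  | confirm (a) : Trans s (obeying a) (.send (.ack a)) sloppy

end Checker

/-- The transitions of the forwarder; it is in the state `some a` while it has to forward the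
order to remove `a`. -/
inductive Forward {Γ : Type} : Option Γ → Action (Msg Γ) → Option Γ → Prop
  | accept (a) : Forward none (.recv (.order a)) (some a)
  | relay (a) : Forward (some a) (.send (.relay a)) none

namespace Controller

variable {Γ : Type} (C : Controller Γ)

/-- The transitions of a controller as a peer. -/
def Trans (x : C.State) : Action (Msg Γ) → C.State → Prop
  | .send (.data a), y => C.push x a y
  | .send (.order a), y => C.order x a y
  | .recv (.ack a), y => C.next x a y
  | _, _ => False

/-- The states of the three peers. -/
def PeerState : Fin 3 → Type
  | 0 => C.State
  | 1 => Checker Γ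
  | 2 => Option Γ

def peerInit : ∀ i, C.PeerState i
  | 0 => C.init
  | 1 => Checker.honest
  | 2 => none

def peerTrans (s : Γ) : ∀ i, C.PeerState i → Action (Msg Γ) → C.PeerState i → Prop
  | 0 => C.Trans
  | 1 => Checker.Trans s
  | 2 => Forward

variable [Finite Γ] [Finite C.State] (s : Γ)

/-- The system of the controller, the checker, which raises the alarm on the letter `s`, and the
forwarder. -/
def system : System (Msg.messageSet Γ) where
  State := C.PeerState
  finite
    | 0 => inferInstanceAs (Finite C.State)
    | 1 => inferInstanceAs (Finite (Checker Γ))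
    | 2 => inferInstanceAs (Finite (Option Γ))
  init := C.peerInit
  trans := C.peerTrans s
  peer_eq
    | 0, _, .send (.data _), _, _ => rfl
    | 0, _, .send (.order _), _, _ => rfl
    | 0, _, .recv (.ack _), _, _ => rfl
    | 1, _, _, _, h => by cases h <;> rfl
    | 2, _, _, _, h => by cases h <;> rfl

variable {C s}

/-- The configuration with given states, and with given contents of the four channels in use. -/
def cfg (x : C.State) (p : Checker Γ) (r : Option Γ) (d o l k : List (Msg Γ)) :
    (C.system s).Config where
  state
    | 0 => x
    | 1 => p
    | 2 => r
  chan
    | 0, 1 => d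
    | 0, 2 => o
    | 2, 1 => l
    | 1, 0 => k
    | _, _ => []

variable {x y : C.State} {p q : Checker Γ} {r t : Option Γ} {d o l k : List (Msg Γ)} {a : Γ}
  {c : (C.system s).Config}

lemma initConfig_eq : (C.system s).initConfig = cfg C.init .honest none [] [] [] [] :=
  System.config_ext (fun i => by fin_cases i <;> rfl)
    (fun i j => by fin_cases i <;> fin_cases j <;> rfl)

lemma isStable_cfg : (cfg x p r d o l k : (C.system s).Config).IsStable ↔
    d = [] ∧ o = [] ∧ l = [] ∧ k = [] := by
  constructor
  · intro h
    exact ⟨h 0 1 (by decide), h 0 2 (by decide), h 2 1 (by decide), h 1 0 (by decide)⟩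
  · rintro ⟨rfl, rfl, rfl, rfl⟩ i j -
    fin_cases i <;> fin_cases j <;> rfl

lemma step_send_data : (C.system s).Step (cfg x p r d o l k) (.send (.data a)) c ↔
    ∃ y, C.push x a y ∧ c = cfg y p r (d ++ [.data a]) o l k := by
  refine (System.step_send_iff (C.system s) (a := .data a)
    (fun (y : C.State) => cfg y p r (d ++ [.data a]) o l k)
    fun _ => ⟨rfl, rfl, fun i hi => ?_, fun i j hij => ?_⟩).trans ?_
  · fin_cases i <;> first | rfl | exact absurd rfl hi
  · fin_cases i <;> fin_cases j <;> first | rfl | exact absurd ⟨rfl, rfl⟩ hij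
  · rfl

lemma step_recv_data : (C.system s).Step (cfg x p r d o l k) (.recv (.data a)) c ↔
    ∃ q w, Checker.Trans s p (.recv (.data a)) q ∧ d = .data a :: w ∧ c = cfg x q r w o l k := by
  refine (System.step_recv_iff (C.system s) (a := .data a)
    (fun (q : Checker Γ) w => cfg x q r w o l k)
    fun _ _ => ⟨rfl, rfl, fun i hi => ?_, fun i j hij => ?_⟩).trans ?_
  · fin_cases i <;> first | rfl | exact absurd rfl hi
  · fin_cases i <;> fin_cases j <;> first | rfl | exact absurd ⟨rfl, rfl⟩ hij
  · rfl

lemma step_send_order : (C.system s).Step (cfg x p r d o l k) (.send (.order a)) c ↔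
    ∃ y, C.order x a y ∧ c = cfg y p r d (o ++ [.order a]) l k := by
  refine (System.step_send_iff (C.system s) (a := .order a)
    (fun (y : C.State) => cfg y p r d (o ++ [.order a]) l k)
    fun _ => ⟨rfl, rfl, fun i hi => ?_, fun i j hij => ?_⟩).trans ?_
  · fin_cases i <;> first | rfl | exact absurd rfl hi
  · fin_cases i <;> fin_cases j <;> first | rfl | exact absurd ⟨rfl, rfl⟩ hij
  · rfl

lemma step_recv_order : (C.system s).Step (cfg x p r d o l k) (.recv (.order a)) c ↔
    ∃ t w, Forward r (.recv (.order a)) t ∧ o = .order a :: w ∧ c = cfg x p t d w l k := by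
  refine (System.step_recv_iff (C.system s) (a := .order a)
    (fun (t : Option Γ) w => cfg x p t d w l k)
    fun _ _ => ⟨rfl, rfl, fun i hi => ?_, fun i j hij => ?_⟩).trans ?_
  · fin_cases i <;> first | rfl | exact absurd rfl hi
  · fin_cases i <;> fin_cases j <;> first | rfl | exact absurd ⟨rfl, rfl⟩ hij
  · rfl

lemma step_send_relay : (C.system s).Step (cfg x p r d o l k) (.send (.relay a)) c ↔
    ∃ t, Forward r (.send (.relay a)) t ∧ c = cfg x p t d o (l ++ [.relay a]) k := by
  refine (System.step_send_iff (C.system s) (a := .relay a)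
    (fun (t : Option Γ) => cfg x p t d o (l ++ [.relay a]) k)
    fun _ => ⟨rfl, rfl, fun i hi => ?_, fun i j hij => ?_⟩).trans ?_
  · fin_cases i <;> first | rfl | exact absurd rfl hi
  · fin_cases i <;> fin_cases j <;> first | rfl | exact absurd ⟨rfl, rfl⟩ hij
  · rfl

lemma step_recv_relay : (C.system s).Step (cfg x p r d o l k) (.recv (.relay a)) c ↔
    ∃ q w, Checker.Trans s p (.recv (.relay a)) q ∧ l = .relay a :: w ∧ c = cfg x q r d o w k := by
  refine (System.step_recv_iff (C.system s) (a := .relay a)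
    (fun (q : Checker Γ) w => cfg x q r d o w k)
    fun _ _ => ⟨rfl, rfl, fun i hi => ?_, fun i j hij => ?_⟩).trans ?_
  · fin_cases i <;> first | rfl | exact absurd rfl hi
  · fin_cases i <;> fin_cases j <;> first | rfl | exact absurd ⟨rfl, rfl⟩ hij
  · rfl

lemma step_send_ack : (C.system s).Step (cfg x p r d o l k) (.send (.ack a)) c ↔
    ∃ q, Checker.Trans s p (.send (.ack a)) q ∧ c = cfg x q r d o l (k ++ [.ack a]) := by
  refine (System.step_send_iff (C.system s) (a := .ack a)
    (fun (q : Checker Γ) => cfg x q r d o l (k ++ [.ack a]))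
    fun _ => ⟨rfl, rfl, fun i hi => ?_, fun i j hij => ?_⟩).trans ?_
  · fin_cases i <;> first | rfl | exact absurd rfl hi
  · fin_cases i <;> fin_cases j <;> first | rfl | exact absurd ⟨rfl, rfl⟩ hij
  · rfl

lemma step_recv_ack : (C.system s).Step (cfg x p r d o l k) (.recv (.ack a)) c ↔
    ∃ y w, C.next x a y ∧ k = .ack a :: w ∧ c = cfg y p r d o l w := by
  refine (System.step_recv_iff (C.system s) (a := .ack a)
    (fun (y : C.State) w => cfg y p r d o l w)
    fun _ _ => ⟨rfl, rfl, fun i hi => ?_, fun i j hij => ?_⟩).trans ?_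
  · fin_cases i <;> first | rfl | exact absurd rfl hi
  · fin_cases i <;> fin_cases j <;> first | rfl | exact absurd ⟨rfl, rfl⟩ hij
  · rfl

lemma step_send_alarm : (C.system s).Step (cfg x p r d o l k) (.send .alarm) c ↔
    ∃ q, Checker.Trans s p (.send .alarm) q ∧ c = cfg x q r d o l (k ++ [.alarm]) := by
  refine (System.step_send_iff (C.system s) (a := .alarm)
    (fun (q : Checker Γ) => cfg x q r d o l (k ++ [.alarm]))
    fun _ => ⟨rfl, rfl, fun i hi => ?_, fun i j hij => ?_⟩).trans ?_
  · fin_cases i <;> first | rfl | exact absurd rfl hi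
  · fin_cases i <;> fin_cases j <;> first | rfl | exact absurd ⟨rfl, rfl⟩ hij
  · rfl

lemma not_step_recv_alarm : ¬ (C.system s).Step (cfg x p r d o l k) (.recv .alarm) c := by
  intro h
  exact h.1

end Controller
end CFSM

namespace CFSM

namespace Checker

variable {Γ : Type}

/-- The relation between the checker's state `p` in some run, its state `p'` in the corresponding
synchronous run, and the queue `d` of the former run, while the checker is not executing orders.
In the synchronous run the checker becomes sloppy with the first letter that it receives. -/
def Link (p p' : Checker Γ) (d : List Γ) : Prop :=
  p' = .sloppy ∧ (p = .sloppy ∨ p = .honest ∧ d ≠ []) ∨ p = .honest ∧ p' = .honest ∧ d = []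

lemma Link.right_eq {p p' : Checker Γ} {d : List Γ} (h : Link p p' d) :
    p' = .honest ∨ p' = .sloppy := by
  rcases h with ⟨rfl, -⟩ | ⟨-, rfl, -⟩ <;> simp

lemma Link.left_eq {p p' : Checker Γ} {d : List Γ} (h : Link p p' d) :
    p = .sloppy ∨ p = .honest := by
  rcases h with ⟨-, rfl | ⟨rfl, -⟩⟩ | ⟨rfl, -, -⟩ <;> simp

/-- A checker that is not executing an order and receives a letter of the queue becomes sloppy. -/
lemma Link.recv_data {s : Γ} {p p' q : Checker Γ} {d : List Γ} {a : Γ} (h : Link p p' (a :: d))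
    (hq : Checker.Trans s p (.recv (.data a)) q) : q = .sloppy ∧ Link q p' d := by
  rcases h with ⟨rfl, rfl | ⟨rfl, -⟩⟩ | ⟨-, -, h⟩
  · cases hq; exact ⟨rfl, .inl ⟨rfl, .inl rfl⟩⟩
  · cases hq; exact ⟨rfl, .inl ⟨rfl, .inl rfl⟩⟩
  · cases h

end Checker

namespace Controller

open Checker (Link)

variable {Γ : Type} {C : Controller Γ} [Finite Γ] [Finite C.State] {s : Γ}

/-! ### The alarm -/

/-- As long as the checker stays honest, the channel from the controller is the queue. -/
lemma Reaches.exists_run {x : C.State} {u : List Γ} (h : C.Reaches x u) :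
    ∃ τ, (C.system s).Run (C.system s).initConfig τ
      (cfg x .honest none (List.map Msg.data u) [] [] []) := by
  induction h with
  | init => exact ⟨[], initConfig_eq⟩
  | push _ h ih =>
    obtain ⟨τ, hτ⟩ := ih
    refine ⟨_, (System.run_snoc _).2 ⟨_, hτ, step_send_data.2 ⟨_, h, ?_⟩⟩⟩
    simp
  | @pop x a z y u _ h h' ih =>
    obtain ⟨τ, hτ⟩ := ih
    refine ⟨τ ++ [.send (.order a), .recv (.order a), .send (.relay a), .recv (.relay a),
      .recv (.data a), .send (.ack a), .recv (.ack a)], (System.run_append _).2 ⟨_, hτ, ?_⟩⟩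
    exact ⟨_, step_send_order.2 ⟨z, h, rfl⟩, _, step_recv_order.2 ⟨_, _, .accept a, rfl, rfl⟩,
      _, step_send_relay.2 ⟨_, .relay a, rfl⟩, _, step_recv_relay.2 ⟨_, _, .hold a, rfl, rfl⟩,
      _, step_recv_data.2 ⟨_, _, .check a, rfl, rfl⟩, _, step_send_ack.2 ⟨_, .report a, rfl⟩,
      _, step_recv_ack.2 ⟨_, _, h', rfl, rfl⟩, rfl⟩

lemma Dequeues.exists_run (h : C.Dequeues s) :
    ∃ τ c, (C.system s).Run (C.system s).initConfig τ c ∧ Msg.alarm ∈ τ.sendProj := by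
  obtain ⟨x, u, z, hu, h⟩ := h
  obtain ⟨τ, hτ⟩ := hu.exists_run (s := s)
  refine ⟨τ ++ [.send (.order s), .recv (.order s), .send (.relay s), .recv (.relay s),
      .recv (.data s), .send .alarm],
    cfg z .honest none (List.map Msg.data u) [] [] ([] ++ [.alarm]),
    (System.run_append _).2 ⟨_, hτ, ?_⟩, ?_⟩
  · exact ⟨_, step_send_order.2 ⟨z, h, rfl⟩, _, step_recv_order.2 ⟨_, _, .accept s, rfl, rfl⟩,
      _, step_send_relay.2 ⟨_, .relay s, rfl⟩, _, step_recv_relay.2 ⟨_, _, .hold s, rfl, rfl⟩,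
      _, step_recv_data.2 ⟨_, _, .check s, rfl, rfl⟩, _, step_send_alarm.2 ⟨_, .alarm, rfl⟩, rfl⟩
  · simp [Trace.sendProj_append]

/-- A message is sent and received at once. -/
def SyncStep (c : (C.system s).Config) (m : Msg Γ) (c' : (C.system s).Config) : Prop :=
  ∃ e, (C.system s).Step c (.send m) e ∧ (C.system s).Step e (.recv m) c'

lemma run_syncTrace_snoc {c c' : (C.system s).Config} {w : List (Msg Γ)} {m : Msg Γ} :
    (C.system s).Run c (syncTrace (w ++ [m])) c' ↔
      ∃ d, (C.system s).Run c (syncTrace w) d ∧ SyncStep d m c' := by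
  rw [syncTrace_append, System.run_append]
  simp [syncTrace, System.Run, SyncStep]

/-- The configurations that occur in synchronous runs: no order is under way, or the forwarder
has it, or the checker has it while the controller waits. -/
inductive SyncReachable : (C.system s).Config → Prop
  | active {x p} : p = .honest ∨ p = .sloppy → SyncReachable (cfg x p none [] [] [] [])
  | ordered {x a z p} : C.order x a z → p = .honest ∨ p = .sloppy →
      SyncReachable (cfg z p (some a) [] [] [] [])
  | relayed {x a z p} : C.order x a z → p = .holding a ∨ p = .obeying a →
      SyncReachable (cfg z p none [] [] [] [])

/-- The alarm is never sent: in a synchronous run an honest checker that holds an order never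
receives the ordered letter, as the controller, which would have to send it just then, is
waiting. -/
lemma SyncReachable.step (hC : C.Waits) {c c' : (C.system s).Config} {m : Msg Γ}
    (h : SyncReachable c) (hm : SyncStep c m c') : m ≠ .alarm ∧ SyncReachable c' := by
  obtain ⟨e, h1, h2⟩ := hm
  cases m with
  | data a =>
    refine ⟨by simp, ?_⟩
    cases h with
    | active hp =>
      obtain ⟨y, -, rfl⟩ := step_send_data.1 h1
      obtain ⟨q, w, hq, hw, rfl⟩ := step_recv_data.1 h2
      obtain rfl : w = [] := by simpa using hw
      rcases hp with rfl | rfl <;> cases hq <;> exact .active (.inr rfl)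
    | ordered ho _ | relayed ho _ =>
      obtain ⟨y, hy, rfl⟩ := step_send_data.1 h1
      exact absurd hy ((hC _ _ _ ho).1 _ _)
  | order a =>
    refine ⟨by simp, ?_⟩
    cases h with
    | active hp =>
      obtain ⟨y, hy, rfl⟩ := step_send_order.1 h1
      obtain ⟨q, w, hq, hw, rfl⟩ := step_recv_order.1 h2
      obtain rfl : w = [] := by simpa using hw
      cases hq
      exact .ordered hy hp
    | ordered ho _ | relayed ho _ =>
      obtain ⟨y, hy, rfl⟩ := step_send_order.1 h1
      exact absurd hy ((hC _ _ _ ho).2.1 _ _)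
  | relay a =>
    refine ⟨by simp, ?_⟩
    cases h with
    | active _ | relayed _ _ =>
      obtain ⟨y, hy, rfl⟩ := step_send_relay.1 h1
      cases hy
    | ordered ho hp =>
      obtain ⟨t, ht, rfl⟩ := step_send_relay.1 h1
      cases ht
      obtain ⟨q, w, hq, hw, rfl⟩ := step_recv_relay.1 h2
      obtain rfl : w = [] := by simpa using hw
      refine .relayed ho ?_
      rcases hp with rfl | rfl <;> cases hq <;> simp
  | ack a =>
    refine ⟨by simp, ?_⟩
    obtain ⟨q, hq, he⟩ : ∃ q, (q = .honest ∨ q = .sloppy) ∧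
        ∃ x, e = cfg x q none [] [] [] [.ack a] := by
      cases h with
      | active hp | ordered _ hp =>
        obtain ⟨q, hq, rfl⟩ := step_send_ack.1 h1
        rcases hp with rfl | rfl <;> cases hq
      | relayed ho hp =>
        obtain ⟨q, hq, rfl⟩ := step_send_ack.1 h1
        rcases hp with rfl | rfl <;> cases hq
        exact ⟨_, .inr rfl, _, rfl⟩
    obtain ⟨x, rfl⟩ := he
    obtain ⟨y, w, -, hw, rfl⟩ := step_recv_ack.1 h2
    obtain rfl : w = [] := by simpa using hw
    exact .active hq
  | alarm =>
    exfalso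
    cases h with
    | active hp | ordered _ hp | relayed _ hp =>
      obtain ⟨q, hq, rfl⟩ := step_send_alarm.1 h1
      rcases hp with rfl | rfl <;> cases hq

lemma syncReachable_of_run (hC : C.Waits) {w : List (Msg Γ)} {c : (C.system s).Config}
    (h : (C.system s).Run (C.system s).initConfig (syncTrace w) c) :
    .alarm ∉ w ∧ SyncReachable c := by
  induction w using List.reverseRecOn generalizing c with
  | nil =>
    cases h
    rw [initConfig_eq]
    exact ⟨by simp, .active (.inl rfl)⟩
  | append_singleton w m ih =>
    obtain ⟨d, hd, hm⟩ := run_syncTrace_snoc.1 h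
    obtain ⟨h1, h2⟩ := ih hd
    obtain ⟨h3, h4⟩ := h2.step hC hm
    exact ⟨by simp [h1, Ne.symm h3], h4⟩

/-- If the letter `s` can be dequeued, then the alarm can be raised, but not synchronously. -/
theorem hasAsyncSend (hC : C.Waits) (h : C.Dequeues s) : (C.system s).HasAsyncSend := by
  obtain ⟨τ, c, hc, hm⟩ := h.exists_run
  exact ⟨.alarm, τ, c, hc, hm, fun w c' h => (syncReachable_of_run hC h).1⟩

/-! ### Synchronous runs with given send traces -/

/-- The relation between the configuration `c` reached by a run and the configuration `c'` reached
by the synchronous run with the same send trace. The messages that are still in a channel in `c`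
have been received in the synchronous run, whose checker is sloppy once it has reacted to a
message, whatever the checker of the first run does. While the latter is honest, the letters in
the channel from the controller, together with a letter that it has just matched, form a queue
that the queue automaton can reach. -/
inductive Match : (C.system s).Config → (C.system s).Config → Prop
  | active {x p p' d} : Link p p' d → (p = .honest → C.Reaches x d) →
      Match (cfg x p none (List.map Msg.data d) [] [] []) (cfg x p' none [] [] [] [])
  | ordered {x z a p p' d} : C.order x a z → Link p p' d → (p = .honest → C.Reaches x d) →
      Match (cfg z p none (List.map Msg.data d) [.order a] [] []) (cfg z p' (some a) [] [] [] [])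
  | accepted {x z a p p' d} : C.order x a z → Link p p' d → (p = .honest → C.Reaches x d) →
      Match (cfg z p (some a) (List.map Msg.data d) [] [] []) (cfg z p' (some a) [] [] [] [])
  | relayed {x z a p d} : C.order x a z → p = .sloppy ∨ p = .honest →
      (p = .honest → C.Reaches x d) →
      Match (cfg z p none (List.map Msg.data d) [] [.relay a] [])
        (cfg z (.obeying a) none [] [] [] [])
  | holding {x z a d} : C.order x a z → C.Reaches x d →
      Match (cfg z (.holding a) none (List.map Msg.data d) [] [] [])
        (cfg z (.obeying a) none [] [] [] [])
  | matched {x z a d} : C.order x a z → C.Reaches x (a :: d) →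
      Match (cfg z (.matched a) none (List.map Msg.data d) [] [] [])
        (cfg z (.obeying a) none [] [] [] [])
  | obeying {x z a d} : C.order x a z →
      Match (cfg z (.obeying a) none (List.map Msg.data d) [] [] [])
        (cfg z (.obeying a) none [] [] [] [])
  | acked {x z a y p d} : C.order x a z → C.next z a y → p = .sloppy ∨ p = .honest →
      (p = .honest → d ≠ [] ∧ C.Reaches y d) →
      Match (cfg z p none (List.map Msg.data d) [] [] [.ack a]) (cfg y .sloppy none [] [] [] [])

/-- The two configurations coincide if the first is stable: the queue is not empty when an honest
checker has begun to execute orders. -/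
lemma Match.eq_of_isStable (hC : C.KeepsTwo) {c c' : (C.system s).Config} (h : Match c c')
    (hc : c.IsStable) : c' = c := by
  cases h with
  | active hl _ | accepted _ hl _ =>
    obtain ⟨h1, -⟩ := isStable_cfg.1 hc
    obtain rfl := List.map_eq_nil_iff.1 h1
    rcases hl with ⟨rfl, rfl | ⟨-, h⟩⟩ | ⟨rfl, rfl, -⟩
    · rfl
    · exact absurd rfl h
    · rfl
  | ordered _ _ _ | relayed _ _ _ | acked _ _ _ _ => simp [isStable_cfg] at hc
  | holding ho hr | matched ho hr =>
    obtain ⟨h1, -⟩ := isStable_cfg.1 hc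
    obtain rfl := List.map_eq_nil_iff.1 h1
    simpa using hC _ _ _ _ hr ho
  | obeying _ =>
    obtain ⟨h1, -⟩ := isStable_cfg.1 hc
    rw [h1]

lemma syncStep_data {x y : C.State} {p : Checker Γ} {a : Γ} (h : C.push x a y)
    (hp : p = .honest ∨ p = .sloppy) :
    SyncStep (s := s) (cfg x p none [] [] [] []) (.data a) (cfg y .sloppy none [] [] [] []) :=
  ⟨_, step_send_data.2 ⟨y, h, rfl⟩, step_recv_data.2
    ⟨_, [], by rcases hp with rfl | rfl <;> constructor, rfl, rfl⟩⟩

lemma syncStep_order {x y : C.State} {p : Checker Γ} {a : Γ} (h : C.order x a y) :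
    SyncStep (s := s) (cfg x p none [] [] [] []) (.order a) (cfg y p (some a) [] [] [] []) :=
  ⟨_, step_send_order.2 ⟨y, h, rfl⟩, step_recv_order.2 ⟨_, [], .accept a, rfl, rfl⟩⟩

lemma syncStep_relay {x : C.State} {p : Checker Γ} {a : Γ} (hp : p = .honest ∨ p = .sloppy) :
    SyncStep (s := s) (cfg x p (some a) [] [] [] []) (.relay a)
      (cfg x (.obeying a) none [] [] [] []) :=
  ⟨_, step_send_relay.2 ⟨_, .relay a, rfl⟩, step_recv_relay.2
    ⟨_, [], by rcases hp with rfl | rfl <;> constructor, rfl, rfl⟩⟩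

lemma syncStep_ack {x y : C.State} {a : Γ} (h : C.next x a y) :
    SyncStep (s := s) (cfg x (.obeying a) none [] [] [] []) (.ack a)
      (cfg y .sloppy none [] [] [] []) :=
  ⟨_, step_send_ack.2 ⟨_, .confirm a, rfl⟩, step_recv_ack.2 ⟨y, [], h, rfl, rfl⟩⟩

/-- A send action is mimicked by sending the message and receiving it at once. -/
lemma Match.send (hC : C.Waits) (h2 : C.KeepsTwo) (hs : ¬ C.Dequeues s)
    {c c' d : (C.system s).Config} {m : Msg Γ} (h : Match c c')
    (hm : (C.system s).Step c (.send m) d) : ∃ d', SyncStep c' m d' ∧ Match d d' := by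
  cases m with
  | data a =>
    cases h with
    | @active x p p' d hl hr =>
      obtain ⟨y, hy, rfl⟩ := step_send_data.1 hm
      refine ⟨_, syncStep_data hy hl.right_eq, ?_⟩
      have := Match.active (s := s) (x := y) (p := p) (p' := .sloppy) (d := d ++ [a])
        (.inl ⟨rfl, by rcases hl.left_eq with rfl | rfl <;> simp⟩) fun hp => (hr hp).push hy
      simpa using this
    | ordered ho _ _ | accepted ho _ _ | relayed ho _ _ | holding ho _ | matched ho _ | obeying ho
    | acked ho _ _ _ =>
      obtain ⟨y, hy, rfl⟩ := step_send_data.1 hm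
      exact absurd hy ((hC _ _ _ ho).1 _ _)
  | order a =>
    cases h with
    | active hl hr =>
      obtain ⟨y, hy, rfl⟩ := step_send_order.1 hm
      exact ⟨_, syncStep_order hy, .ordered hy hl hr⟩
    | ordered ho _ _ | accepted ho _ _ | relayed ho _ _ | holding ho _ | matched ho _ | obeying ho
    | acked ho _ _ _ =>
      obtain ⟨y, hy, rfl⟩ := step_send_order.1 hm
      exact absurd hy ((hC _ _ _ ho).2.1 _ _)
  | relay a =>
    cases h with
    | accepted ho hl hr =>
      obtain ⟨t, ht, rfl⟩ := step_send_relay.1 hm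
      cases ht
      exact ⟨_, syncStep_relay hl.right_eq, .relayed ho hl.left_eq hr⟩
    | active _ _ | ordered _ _ _ | relayed _ _ _ | holding _ _ | matched _ _ | obeying _
    | acked _ _ _ _ =>
      obtain ⟨t, ht, rfl⟩ := step_send_relay.1 hm
      cases ht
  | ack a =>
    cases h with
    | active hl _ | ordered _ hl _ | accepted _ hl _ =>
      obtain ⟨q, hq, rfl⟩ := step_send_ack.1 hm
      rcases hl.left_eq with rfl | rfl <;> cases hq
    | relayed _ hp _ | acked _ _ hp _ =>
      obtain ⟨q, hq, rfl⟩ := step_send_ack.1 hm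
      rcases hp with rfl | rfl <;> cases hq
    | holding _ _ =>
      obtain ⟨q, hq, rfl⟩ := step_send_ack.1 hm
      cases hq
    | matched ho hr =>
      obtain ⟨q, hq, rfl⟩ := step_send_ack.1 hm
      cases hq
      obtain ⟨y, hy⟩ := (hC _ _ _ ho).2.2
      have hy := (hy a y).2 ⟨rfl, rfl⟩
      refine ⟨_, syncStep_ack hy, .acked ho hy (.inr rfl) fun _ => ⟨?_, hr.pop ho hy⟩⟩
      rintro rfl
      simpa using h2 _ _ _ _ hr ho
    | obeying ho =>
      obtain ⟨q, hq, rfl⟩ := step_send_ack.1 hm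
      cases hq
      obtain ⟨y, hy⟩ := (hC _ _ _ ho).2.2
      have hy := (hy a y).2 ⟨rfl, rfl⟩
      exact ⟨_, syncStep_ack hy, .acked ho hy (.inl rfl) (by simp)⟩
  | alarm =>
    exfalso
    cases h with
    | active hl _ | ordered _ hl _ | accepted _ hl _ =>
      obtain ⟨q, hq, rfl⟩ := step_send_alarm.1 hm
      rcases hl.left_eq with rfl | rfl <;> cases hq
    | relayed _ hp _ | acked _ _ hp _ =>
      obtain ⟨q, hq, rfl⟩ := step_send_alarm.1 hm
      rcases hp with rfl | rfl <;> cases hq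
    | holding _ _ | obeying _ =>
      obtain ⟨q, hq, rfl⟩ := step_send_alarm.1 hm
      cases hq
    | matched ho hr =>
      obtain ⟨q, hq, rfl⟩ := step_send_alarm.1 hm
      cases hq
      exact hs ⟨_, _, _, hr, ho⟩

/-- A receive action needs no counterpart: the message has already been received. -/
lemma Match.recv (hC : C.Waits) {c c' d : (C.system s).Config} {m : Msg Γ} (h : Match c c')
    (hm : (C.system s).Step c (.recv m) d) : Match d c' := by
  cases m with
  | data a =>
    cases h with
    | active hl hr =>
      obtain ⟨q, w, hq, hw, rfl⟩ := step_recv_data.1 hm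
      obtain ⟨b, d', rfl, hb, rfl⟩ := List.map_eq_cons_iff.1 hw
      cases hb
      obtain ⟨rfl, hl'⟩ := hl.recv_data hq
      exact .active hl' (by simp)
    | ordered ho hl hr =>
      obtain ⟨q, w, hq, hw, rfl⟩ := step_recv_data.1 hm
      obtain ⟨b, d', rfl, hb, rfl⟩ := List.map_eq_cons_iff.1 hw
      cases hb
      obtain ⟨rfl, hl'⟩ := hl.recv_data hq
      exact .ordered ho hl' (by simp)
    | accepted ho hl hr =>
      obtain ⟨q, w, hq, hw, rfl⟩ := step_recv_data.1 hm
      obtain ⟨b, d', rfl, hb, rfl⟩ := List.map_eq_cons_iff.1 hw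
      cases hb
      obtain ⟨rfl, hl'⟩ := hl.recv_data hq
      exact .accepted ho hl' (by simp)
    | relayed ho hp hr =>
      obtain ⟨q, w, hq, hw, rfl⟩ := step_recv_data.1 hm
      obtain ⟨b, d', rfl, hb, rfl⟩ := List.map_eq_cons_iff.1 hw
      cases hb
      rcases hp with rfl | rfl <;> cases hq <;> exact .relayed ho (.inl rfl) (by simp)
    | holding ho hr =>
      obtain ⟨q, w, hq, hw, rfl⟩ := step_recv_data.1 hm
      obtain ⟨b, d', rfl, hb, rfl⟩ := List.map_eq_cons_iff.1 hw
      cases hb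
      cases hq
      exact .matched ho hr
    | matched ho hr | obeying ho =>
      obtain ⟨q, w, hq, -⟩ := step_recv_data.1 hm
      cases hq
    | acked ho hn hp hr =>
      obtain ⟨q, w, hq, hw, rfl⟩ := step_recv_data.1 hm
      obtain ⟨b, d', rfl, hb, rfl⟩ := List.map_eq_cons_iff.1 hw
      cases hb
      rcases hp with rfl | rfl <;> cases hq <;> exact .acked ho hn (.inl rfl) (by simp)
  | order a =>
    cases h with
    | ordered ho hl hr =>
      obtain ⟨t, w, ht, hw, rfl⟩ := step_recv_order.1 hm
      cases hw
      cases ht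
      exact .accepted ho hl hr
    | active _ _ | accepted _ _ _ | relayed _ _ _ | holding _ _ | matched _ _ | obeying _
    | acked _ _ _ _ =>
      obtain ⟨t, w, -, hw, -⟩ := step_recv_order.1 hm
      cases hw
  | relay a =>
    cases h with
    | relayed ho hp hr =>
      obtain ⟨q, w, hq, hw, rfl⟩ := step_recv_relay.1 hm
      cases hw
      cases hq with
      | hold => exact .holding ho (hr rfl)
      | yield => exact .obeying ho
      | obey => exact .obeying ho
    | active _ _ | ordered _ _ _ | accepted _ _ _ | holding _ _ | matched _ _ | obeying _
    | acked _ _ _ _ =>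
      obtain ⟨q, w, -, hw, -⟩ := step_recv_relay.1 hm
      cases hw
  | ack a =>
    cases h with
    | acked ho hn hp hr =>
      obtain ⟨y, w, hy, hw, rfl⟩ := step_recv_ack.1 hm
      cases hw
      -- The controller has only one way to go on, so both runs lead it to the same state.
      obtain ⟨y₀, hy₀⟩ := (hC _ _ _ ho).2.2
      obtain ⟨-, rfl⟩ := (hy₀ _ _).1 hn
      obtain ⟨-, rfl⟩ := (hy₀ _ _).1 hy
      refine .active (.inl ⟨rfl, ?_⟩) fun h => (hr h).2
      rcases hp with rfl | rfl
      · exact .inl rfl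
      · exact .inr ⟨rfl, (hr rfl).1⟩
    | active _ _ | ordered _ _ _ | accepted _ _ _ | relayed _ _ _ | holding _ _ | matched _ _
    | obeying _ =>
      obtain ⟨y, w, -, hw, -⟩ := step_recv_ack.1 hm
      cases hw
  | alarm => cases h <;> exact absurd hm not_step_recv_alarm

/-- If the letter `s` cannot be dequeued, then every run has a synchronous counterpart. -/
theorem hasSyncRuns (hC : C.Waits) (h2 : C.KeepsTwo) (hs : ¬ C.Dequeues s) :
    (C.system s).HasSyncRuns := by
  suffices h : ∀ τ c, (C.system s).Run (C.system s).initConfig τ c →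
      ∃ c', (C.system s).Run (C.system s).initConfig (syncTrace τ.sendProj) c' ∧ Match c c' by
    intro τ c hc
    obtain ⟨c', hc', hm⟩ := h τ c hc
    exact ⟨c', hc', hm.eq_of_isStable h2⟩
  intro τ
  induction τ using List.reverseRecOn with
  | nil =>
    rintro c rfl
    refine ⟨_, rfl, ?_⟩
    rw [initConfig_eq]
    exact .active (d := []) (.inr ⟨rfl, rfl, rfl⟩) fun _ => .init
  | append_singleton τ α ih =>
    intro c hc
    obtain ⟨d, hd, hα⟩ := (System.run_snoc _).1 hc
    obtain ⟨d', hd', hm⟩ := ih d hd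
    rw [Trace.sendProj_append]
    cases α with
    | send m =>
      obtain ⟨c', h1, h2⟩ := hm.send hC h2 hs hα
      exact ⟨c', run_syncTrace_snoc.2 ⟨d', hd', h1⟩, h2⟩
    | recv m => exact ⟨d', by simpa using hd', hm.recv hC hα⟩

end Controller
end CFSM

namespace CFSM

open Turing Relation

/-! ### Simulating a machine with stacks by a queue -/

/-- The letters of the queue: the stack `k` with content `x₁ ⋯ xₘ` (top first) is represented by
`mark k` followed by `sym x₁, …, sym xₘ`; `halted` shows that the machine has halted. -/
inductive Letter (K G : Type) where
  | mark (k : K)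
  | sym (x : G)
  | halted

namespace Letter

variable {K G : Type}

def equivSum : Letter K G ≃ (K ⊕ G) ⊕ Unit where
  toFun
    | mark k => .inl (.inl k)
    | sym x => .inl (.inr x)
    | halted => .inr ()
  invFun
    | .inl (.inl k) => mark k
    | .inl (.inr x) => sym x
    | .inr () => halted
  left_inv := by rintro (_ | _ | _) <;> rfl
  right_inv := by rintro ((_ | _) | _) <;> rfl

instance [Finite K] [Finite G] : Finite (Letter K G) := Finite.of_equiv _ equivSum.symm

end Letter

namespace QueueSim

open Letter List

variable {K G Λ σ : Type}

/-- The word that represents the stacks `S k` for `k` in `ks`. -/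
def tape (ks : List K) (S : K → List G) : List (Letter K G) :=
  ks.flatMap fun k => mark k :: (S k).map sym

variable {ks ks' : List K} {S : K → List G} {k : K} {u : List (Letter K G)}

lemma tape_cons : tape (k :: ks) S = mark k :: ((S k).map sym ++ tape ks S) := by
  simp [tape]

lemma tape_append : tape (ks ++ ks') S = tape ks S ++ tape ks' S := by
  simp [tape]

lemma mark_mem_tape : mark k ∈ tape ks S ↔ k ∈ ks := by
  simp [tape]

lemma halted_notMem_tape : halted ∉ tape ks S := by
  simp [tape]

lemma length_le_length_tape : ks.length ≤ (tape ks S).length := by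
  induction ks with
  | nil => simp
  | cons k ks ih =>
    simp only [tape_cons, length_cons, length_append]
    omega

lemma tape_isRotated (h : ks ~r ks') : tape ks S ~r tape ks' S := by
  obtain ⟨n, rfl⟩ := h
  induction n generalizing ks with
  | zero => rw [rotate_zero]
  | succ n ih =>
    cases ks with
    | nil => rw [rotate_nil]
    | cons k ks =>
      rw [rotate_cons_succ]
      refine IsRotated.trans ?_ ih
      have : tape (k :: ks) S = (mark k :: (S k).map sym) ++ tape ks S := by simp [tape_cons]
      rw [this, tape_append, show tape [k] S = mark k :: (S k).map sym by simp [tape]]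
      exact isRotated_append

lemma tape_update [DecidableEq K] {t : List G} (h : k ∉ ks) :
    tape ks (Function.update S k t) = tape ks S := by
  refine flatMap_congr fun j hj => ?_
  rw [Function.update_of_ne (ne_of_mem_of_not_mem hj h)]

lemma eq_of_cons_isRotated_cons {α : Type} {x : α} {u v : List α} (h : x :: v ~r x :: u)
    (hv : x ∉ v) : u = v := by
  obtain ⟨n, hn, h⟩ := isRotated_iff_mod.1 h
  rw [rotate_eq_drop_append_take hn] at h
  rcases n with _ | n
  · simpa using h.symm
  · rw [drop_succ_cons, take_succ_cons] at h
    cases hd : drop n v with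
    | nil =>
      rw [hd, nil_append, cons.injEq] at h
      rw [← h.2, take_of_length_le (by simpa using drop_eq_nil_iff.1 hd)]
    | cons y t =>
      rw [hd, cons_append, cons.injEq] at h
      refine absurd (mem_of_mem_drop (i := n) ?_) hv
      rw [hd, h.1]
      exact mem_cons_self

/-- When the queue is turned so that `mark k` is in front, then the stack `k` follows. -/
lemma exists_eq_of_mark_cons (hks : ks.Nodup) (h : mark k :: u ~r tape ks S) :
    ∃ ks', k :: ks' ~r ks ∧ k ∉ ks' ∧ u = (S k).map sym ++ tape ks' S := by
  have hk : k ∈ ks := mark_mem_tape.1 (h.mem_iff.1 mem_cons_self)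
  obtain ⟨A, B, rfl⟩ := append_of_mem hk
  have hr : k :: (B ++ A) ~r A ++ k :: B := by
    simpa using isRotated_append (l := k :: B) (l' := A)
  have hn : k ∉ B ++ A := (nodup_cons.1 (hr.nodup_iff.2 hks)).1
  refine ⟨B ++ A, hr, hn, ?_⟩
  have h2 := (tape_isRotated (S := S) hr).trans h.symm
  rw [tape_cons] at h2
  refine eq_of_cons_isRotated_cons h2 ?_
  simpa [mark_mem_tape] using hn

/-- The front of a queue that begins with the rest of a stack. -/
lemma append_tape_eq_sym_cons {l : List G} {x : G} :
    l.map sym ++ (tape ks S ++ [mark k]) = sym x :: u ↔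
      ∃ t, l = x :: t ∧ u = t.map sym ++ (tape ks S ++ [mark k]) := by
  cases l with
  | nil => cases ks <;> simp [tape]
  | cons y l =>
    simp only [map_cons, cons_append, cons.injEq, sym.injEq, and_assoc]
    constructor
    · rintro ⟨rfl, rfl⟩
      exact ⟨l, rfl, rfl, rfl⟩
    · rintro ⟨t, rfl, rfl, rfl⟩
      exact ⟨rfl, rfl⟩

lemma exists_tape_append_eq (ks : List K) (S : K → List G) (k : K) :
    ∃ j u, tape ks S ++ [mark k] = mark j :: u := by
  cases ks with
  | nil => exact ⟨k, [], rfl⟩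
  | cons j ks => exact ⟨j, _, by rw [tape_cons, cons_append]⟩

lemma append_tape_eq_mark_cons {l : List G} {j : K}
    (h : l.map sym ++ (tape ks S ++ [mark k]) = mark j :: u) :
    l = [] ∧ mark j :: u = tape ks S ++ [mark k] := by
  cases l with
  | nil => exact ⟨rfl, h.symm⟩
  | cons y l => simp at h

/-- The control states of the simulation: `boot` before the machine starts, `run q v` when the
statement `q` has to be executed with local store `v`, `top q v` when `q` reads a stack whose mark
has just been moved to the end of the queue, and `fin` when the machine has halted. -/
inductive Ctl (K G Λ σ : Type) where
  | boot
  | run (q : TM2.Stmt (fun _ : K => G) Λ σ) (v : σ)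
  | top (q : TM2.Stmt (fun _ : K => G) Λ σ) (v : σ)
  | fin

open TM2.Stmt Ctl

/-- The rules of the simulation: `Rule M l₀ v₀ s a w s'` says that `a` may be removed from the
front of the queue and `w` appended, while the control state changes from `s` to `s'`. While a
statement waits to be executed, the queue may be turned by `rotate`; a stack operation is possible
when the mark of its stack is in front. -/
inductive Rule (M : Λ → TM2.Stmt (fun _ : K => G) Λ σ) (l₀ : Λ) (v₀ : σ) :
    Ctl K G Λ σ → Letter K G → List (Letter K G) → Ctl K G Λ σ → Prop
  | boot (a) : Rule M l₀ v₀ boot a [a] (run (M l₀) v₀)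
  | rotate (q v a) : Rule M l₀ v₀ (run q v) a [a] (run q v)
  | push (k f q v) : Rule M l₀ v₀ (run (push k f q) v) (mark k) [mark k, sym (f v)] (run q v)
  | peek (k f q v) : Rule M l₀ v₀ (run (peek k f q) v) (mark k) [mark k] (top (peek k f q) v)
  | peekSym (k f q v x) :
      Rule M l₀ v₀ (top (peek k f q) v) (sym x) [sym x] (run q (f v (some x)))
  | peekMark (k f q v j) :
      Rule M l₀ v₀ (top (peek k f q) v) (mark j) [mark j] (run q (f v none))
  | pop (k f q v) : Rule M l₀ v₀ (run (pop k f q) v) (mark k) [mark k] (top (pop k f q) v)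
  | popSym (k f q v x) : Rule M l₀ v₀ (top (pop k f q) v) (sym x) [] (run q (f v (some x)))
  | popMark (k f q v j) :
      Rule M l₀ v₀ (top (pop k f q) v) (mark j) [mark j] (run q (f v none))
  | load (f q v a) : Rule M l₀ v₀ (run (load f q) v) a [a] (run q (f v))
  | branch (f q₁ q₂ v a) :
      Rule M l₀ v₀ (run (branch f q₁ q₂) v) a [a] (run (cond (f v) q₁ q₂) v)
  | goto (f v a) : Rule M l₀ v₀ (run (goto f) v) a [a] (run (M (f v)) v)
  | halt (v a) : Rule M l₀ v₀ (run halt v) a [halted] fin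
  | fin (a) : Rule M l₀ v₀ fin a [a] fin

variable (M : Λ → TM2.Stmt (fun _ : K => G) Λ σ) (l₀ : Λ) (v₀ : σ)

/-- One application of a rule to a control state with a queue. -/
inductive QStep : Ctl K G Λ σ × List (Letter K G) → Ctl K G Λ σ × List (Letter K G) → Prop
  | mk {s a w s' u} : Rule M l₀ v₀ s a w s' → QStep (s, a :: u) (s', u ++ w)

variable {M l₀ v₀}

lemma reaches_of_isRotated {s : Ctl K G Λ σ} (hs : ∀ a, Rule M l₀ v₀ s a [a] s)
    {u u' : List (Letter K G)} (h : u ~r u') :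
    ReflTransGen (QStep M l₀ v₀) (s, u) (s, u') := by
  obtain ⟨n, rfl⟩ := h
  induction n generalizing u with
  | zero => rw [rotate_zero]
  | succ n ih =>
    cases u with
    | nil => rw [rotate_nil]
    | cons a u =>
      rw [rotate_cons_succ]
      exact .head (.mk (hs a)) ih

variable (M l₀ v₀) in
/-- From `run q v` and any queue that represents the stacks `S`, the simulation leads to the
machine configuration `c`, or to `halted` in front of the queue if `c` is a halting one. -/
def Simulates (ks : List K) (q : TM2.Stmt (fun _ : K => G) Λ σ) (v : σ) (S : K → List G)
    (c : TM2.Cfg (fun _ : K => G) Λ σ) : Prop :=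
  ∀ u, u ~r tape ks S → match c with
    | ⟨some l, v', S'⟩ => ∃ u', u' ~r tape ks S' ∧
        ReflTransGen (QStep M l₀ v₀) (run q v, u) (run (M l) v', u')
    | ⟨none, _, _⟩ => ∃ u', ReflTransGen (QStep M l₀ v₀) (run q v, u) (fin, halted :: u')

lemma Simulates.head {q q' : TM2.Stmt (fun _ : K => G) Λ σ} {v v' : σ} {S S' : K → List G}
    {c : TM2.Cfg (fun _ : K => G) Λ σ} (h : Simulates M l₀ v₀ ks q' v' S' c)
    (hq : ∀ u, u ~r tape ks S → ∃ u', u' ~r tape ks S' ∧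
      ReflTransGen (QStep M l₀ v₀) (run q v, u) (run q' v', u')) :
    Simulates M l₀ v₀ ks q v S c := by
  intro u hu
  obtain ⟨u', h1, h2⟩ := hq u hu
  obtain ⟨_ | l, v₁, S₁⟩ := c
  · obtain ⟨u₁, h3⟩ := h u' h1
    exact ⟨u₁, h2.trans h3⟩
  · obtain ⟨u₁, h3, h4⟩ := h u' h1
    exact ⟨u₁, h3, h2.trans h4⟩

lemma exists_reaches_of_rule (hks : ks ≠ []) {q q' : TM2.Stmt (fun _ : K => G) Λ σ} {v v' : σ}
    {S : K → List G} (hr : ∀ a, Rule M l₀ v₀ (run q v) a [a] (run q' v')) (hu : u ~r tape ks S) :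
    ∃ u', u' ~r tape ks S ∧
      ReflTransGen (QStep M l₀ v₀) (run q v, u) (run q' v', u') := by
  cases u with
  | nil =>
    have := hu.perm.length_eq ▸ length_le_length_tape (ks := ks) (S := S)
    exact absurd (length_eq_zero_iff.1 (Nat.le_zero.1 this)) hks
  | cons a u => exact ⟨u ++ [a], (isRotated_concat _ _).trans hu, .single (.mk (hr a))⟩

/-- Any stack can be brought to the front. -/
lemma exists_reaches_mark (hk : k ∈ ks) (q : TM2.Stmt (fun _ : K => G) Λ σ) (v : σ)
    {S : K → List G} (hu : u ~r tape ks S) :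
    ∃ ks', k :: ks' ~r ks ∧ ReflTransGen (QStep M l₀ v₀) (run q v, u)
      (run q v, mark k :: ((S k).map sym ++ tape ks' S)) := by
  obtain ⟨A, B, rfl⟩ := append_of_mem hk
  have hr : k :: (B ++ A) ~r A ++ k :: B := by
    simpa using isRotated_append (l := k :: B) (l' := A)
  refine ⟨B ++ A, hr, reaches_of_isRotated (fun a => .rotate q v a) (hu.trans ?_)⟩
  rw [← tape_cons]
  exact tape_isRotated hr.symm

variable (M l₀ v₀) in
/-- The machine halts when started with the stacks `S₀`. -/
def Halts [DecidableEq K] (S₀ : K → List G) : Prop :=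
  ∃ v S, TM2.Reaches M ⟨some l₀, v₀, S₀⟩ ⟨none, v, S⟩

variable (M l₀ v₀) in
/-- While executing a reachable label, the machine still has to execute `q` with local store `v`
and stacks `S`. -/
def Live [DecidableEq K] (S₀ : K → List G) (q : TM2.Stmt (fun _ : K => G) Λ σ) (v : σ)
    (S : K → List G) : Prop :=
  TM2.Reaches M ⟨some l₀, v₀, S₀⟩ (TM2.stepAux q v S)

variable [DecidableEq K] {S₀ : K → List G}

/-- An invariant of the simulation. The queue represents the stacks of the machine, up to
rotation; in the state `top q v` it begins with the content of the stack that `q` reads, and the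
mark of that stack is at its end. -/
def Inv (M : Λ → TM2.Stmt (fun _ : K => G) Λ σ) (l₀ : Λ) (v₀ : σ) (ks : List K)
    (S₀ : K → List G) : Ctl K G Λ σ → List (Letter K G) → Prop
  | boot, u => u = tape ks S₀
  | run q v, u => ∃ S, Live M l₀ v₀ S₀ q v S ∧ u ~r tape ks S
  | top q v, u => ∃ S k ks' f q', (q = pop k f q' ∨ q = peek k f q') ∧ Live M l₀ v₀ S₀ q v S ∧
      k :: ks' ~r ks ∧ k ∉ ks' ∧ u = (S k).map sym ++ (tape ks' S ++ [mark k])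
  | fin, _ => Halts M l₀ v₀ S₀

lemma Live.goto {f : σ → Λ} {v : σ} {S : K → List G} (h : Live M l₀ v₀ S₀ (goto f) v S) :
    Live M l₀ v₀ S₀ (M (f v)) v S :=
  ReflTransGen.tail h rfl

lemma Inv.rule (hks : ks.Nodup) {s s' : Ctl K G Λ σ} {a : Letter K G} {w : List (Letter K G)}
    (h : Inv M l₀ v₀ ks S₀ s (a :: u)) (hr : Rule M l₀ v₀ s a w s') :
    Inv M l₀ v₀ ks S₀ s' (u ++ w) := by
  cases hr with
  | boot =>
    refine ⟨S₀, ReflTransGen.single rfl, ?_⟩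
    rw [← show _ = tape ks S₀ from h]
    exact isRotated_concat _ _
  | rotate =>
    obtain ⟨S, hl, hu⟩ := h
    exact ⟨S, hl, (isRotated_concat _ _).trans hu⟩
  | push k f q v =>
    obtain ⟨S, hl, hu⟩ := h
    obtain ⟨ks', h1, h2, rfl⟩ := exists_eq_of_mark_cons hks hu
    refine ⟨Function.update S k (f v :: S k), hl, IsRotated.trans ?_ (tape_isRotated h1)⟩
    rw [tape_cons, tape_update h2, Function.update_self]
    exact isRotated_append (l' := [mark k, sym (f v)])
  | peek k f q v =>
    obtain ⟨S, hl, hu⟩ := h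
    obtain ⟨ks', h1, h2, rfl⟩ := exists_eq_of_mark_cons hks hu
    exact ⟨S, k, ks', f, q, .inr rfl, hl, h1, h2, by simp⟩
  | pop k f q v =>
    obtain ⟨S, hl, hu⟩ := h
    obtain ⟨ks', h1, h2, rfl⟩ := exists_eq_of_mark_cons hks hu
    exact ⟨S, k, ks', f, q, .inl rfl, hl, h1, h2, by simp⟩
  | peekSym k f q v x =>
    obtain ⟨S, k, ks', f, q', he, hl, h1, h2, hu⟩ := h
    obtain he | he := he <;> cases he
    obtain ⟨t, ht, rfl⟩ := append_tape_eq_sym_cons.1 hu.symm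
    refine ⟨S, by simpa [Live, ht] using hl, IsRotated.trans ?_ (tape_isRotated h1)⟩
    rw [tape_cons, ht]
    refine (isRotated_concat _ _).trans ?_
    rw [← append_assoc]
    exact isRotated_concat (mark k) (sym x :: (t.map sym ++ tape ks' S))
  | peekMark k f q v j =>
    obtain ⟨S, k, ks', f, q', he, hl, h1, h2, hu⟩ := h
    obtain he | he := he <;> cases he
    obtain ⟨ht, h3⟩ := append_tape_eq_mark_cons hu.symm
    refine ⟨S, by simpa [Live, ht] using hl, IsRotated.trans ?_ (tape_isRotated h1)⟩
    rw [tape_cons, ht]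
    refine (isRotated_concat _ _).trans ?_
    rw [h3]
    exact isRotated_concat _ _
  | popSym k f q v x =>
    obtain ⟨S, k, ks', f, q', he, hl, h1, h2, hu⟩ := h
    obtain he | he := he <;> cases he
    obtain ⟨t, ht, rfl⟩ := append_tape_eq_sym_cons.1 hu.symm
    refine ⟨Function.update S k t, by simpa [Live, ht] using hl,
      IsRotated.trans ?_ (tape_isRotated h1)⟩
    rw [tape_cons, tape_update h2, Function.update_self]
    rw [append_nil, ← append_assoc]
    exact isRotated_concat (mark k) (t.map sym ++ tape ks' S)
  | popMark k f q v j =>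
    obtain ⟨S, k, ks', f, q', he, hl, h1, h2, hu⟩ := h
    obtain he | he := he <;> cases he
    obtain ⟨ht, h3⟩ := append_tape_eq_mark_cons hu.symm
    have hS : Function.update S k [] = S := by rw [← ht, Function.update_eq_self]
    refine ⟨S, by simpa [Live, ht, hS] using hl, IsRotated.trans ?_ (tape_isRotated h1)⟩
    rw [tape_cons, ht]
    refine (isRotated_concat _ _).trans ?_
    rw [h3]
    exact isRotated_concat _ _
  | load f q v =>
    obtain ⟨S, hl, hu⟩ := h
    exact ⟨S, hl, (isRotated_concat _ _).trans hu⟩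
  | branch f q₁ q₂ v =>
    obtain ⟨S, hl, hu⟩ := h
    refine ⟨S, ?_, (isRotated_concat _ _).trans hu⟩
    cases hf : f v <;> simpa [Live, hf] using hl
  | goto f v =>
    obtain ⟨S, hl, hu⟩ := h
    exact ⟨S, hl.goto, (isRotated_concat _ _).trans hu⟩
  | halt v =>
    obtain ⟨S, hl, hu⟩ := h
    exact ⟨v, S, hl⟩
  | fin => exact h

lemma inv_of_reaches (hks : ks.Nodup) {s : Ctl K G Λ σ}
    (h : ReflTransGen (QStep M l₀ v₀) (boot, tape ks S₀) (s, u)) :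
    Inv M l₀ v₀ ks S₀ s u := by
  suffices ∀ x, ReflTransGen (QStep M l₀ v₀) (boot, tape ks S₀) x →
      Inv M l₀ v₀ ks S₀ x.1 x.2 from this _ h
  intro x hx
  induction hx with
  | refl => rfl
  | tail _ h ih =>
    cases h with
    | mk h => exact ih.rule hks h

/-- Only a machine that has halted can remove the letter `halted`. -/
lemma Inv.halts_of_halted {s s' : Ctl K G Λ σ} {w : List (Letter K G)}
    (h : Inv M l₀ v₀ ks S₀ s (halted :: u)) (hr : Rule M l₀ v₀ s halted w s') :
    Halts M l₀ v₀ S₀ := by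
  cases hr with
  | boot =>
    refine absurd ?_ (halted_notMem_tape (ks := ks) (S := S₀))
    rw [← show _ = tape ks S₀ from h]
    exact mem_cons_self
  | rotate | load | branch | goto | halt =>
    obtain ⟨S, -, hu⟩ := h
    exact absurd (hu.mem_iff.1 mem_cons_self) halted_notMem_tape
  | fin => exact h

/-- The marks of the stacks keep the queue from becoming short. -/
lemma Inv.two_le_length (hks : 2 ≤ ks.length) (hn : ¬ Halts M l₀ v₀ S₀) {s : Ctl K G Λ σ}
    (h : Inv M l₀ v₀ ks S₀ s u) : 2 ≤ u.length := by
  cases s with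
  | boot =>
    obtain rfl : u = tape ks S₀ := h
    exact hks.trans length_le_length_tape
  | run q v =>
    obtain ⟨S, -, hu⟩ := h
    rw [hu.perm.length_eq]
    exact hks.trans length_le_length_tape
  | top q v =>
    obtain ⟨S, k, ks', f, q', -, -, h1, -, rfl⟩ := h
    have h2 := h1.perm.length_eq
    have h3 := length_le_length_tape (ks := ks') (S := S)
    simp only [length_cons, length_append, length_map] at h2 ⊢
    omega
  | fin => exact absurd h hn

/-- By turning the queue as needed, the simulation can carry out every statement. -/
lemma simulates_stepAux (hks : ks.Nodup) (hall : ∀ k, k ∈ ks) [Nonempty K]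
    (q : TM2.Stmt (fun _ : K => G) Λ σ) (v : σ) (S : K → List G) :
    Simulates M l₀ v₀ ks q v S (TM2.stepAux q v S) := by
  have hne : ks ≠ [] := ne_nil_of_mem (hall (Classical.arbitrary K))
  induction q generalizing v S with
  | push k f q ih =>
    refine (ih v (Function.update S k (f v :: S k))).head fun u hu => ?_
    obtain ⟨ks', h1, h2⟩ := exists_reaches_mark (M := M) (l₀ := l₀) (v₀ := v₀) (hall k)
      (push k f q) v hu
    have hk : k ∉ ks' := (nodup_cons.1 (h1.nodup_iff.2 hks)).1
    refine ⟨_, ?_, h2.tail (.mk (.push k f q v))⟩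
    refine IsRotated.trans ?_ (tape_isRotated h1)
    rw [tape_cons, tape_update hk, Function.update_self]
    exact isRotated_append (l' := [mark k, sym (f v)])
  | peek k f q ih =>
    refine (ih (f v (S k).head?) S).head fun u hu => ?_
    obtain ⟨ks', h1, h2⟩ := exists_reaches_mark (M := M) (l₀ := l₀) (v₀ := v₀) (hall k)
      (peek k f q) v hu
    have h3 := h2.tail (.mk (.peek k f q v))
    have h4 : (S k).map sym ++ tape ks' S ++ [mark k] ~r tape ks S := by
      refine (isRotated_concat _ _).trans ?_
      rw [← tape_cons]
      exact tape_isRotated h1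
    cases hS : S k with
    | nil =>
      rw [hS] at h3 h4
      obtain ⟨j, w, hw⟩ := exists_tape_append_eq ks' S k
      rw [map_nil, nil_append, hw] at h3 h4
      exact ⟨_, (isRotated_concat _ _).trans h4, h3.tail (.mk (.peekMark k f q v j))⟩
    | cons x t =>
      rw [hS] at h3 h4
      exact ⟨_, (isRotated_concat _ _).trans h4, h3.tail (.mk (.peekSym k f q v x))⟩
  | pop k f q ih =>
    refine (ih (f v (S k).head?) (Function.update S k (S k).tail)).head fun u hu => ?_
    obtain ⟨ks', h1, h2⟩ := exists_reaches_mark (M := M) (l₀ := l₀) (v₀ := v₀) (hall k)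
      (pop k f q) v hu
    have hk : k ∉ ks' := (nodup_cons.1 (h1.nodup_iff.2 hks)).1
    have h3 := h2.tail (.mk (.pop k f q v))
    have h4 : (S k).tail.map sym ++ tape ks' S ++ [mark k] ~r
        tape ks (Function.update S k (S k).tail) := by
      refine (isRotated_concat _ _).trans ?_
      have e : tape (k :: ks') (Function.update S k (S k).tail) =
          mark k :: ((S k).tail.map sym ++ tape ks' S) := by
        rw [tape_cons, tape_update hk, Function.update_self]
      exact e ▸ tape_isRotated h1
    cases hS : S k with
    | nil =>
      rw [hS] at h3 h4
      obtain ⟨j, w, hw⟩ := exists_tape_append_eq ks' S k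
      rw [tail_nil, map_nil, nil_append, hw] at h4
      rw [map_nil, nil_append, hw] at h3
      exact ⟨_, (isRotated_concat _ _).trans h4, h3.tail (.mk (.popMark k f q v j))⟩
    | cons x t =>
      rw [hS] at h3 h4
      refine ⟨_, ?_, h3.tail (.mk (.popSym k f q v x))⟩
      rw [append_nil]
      exact h4
  | load f q ih => exact (ih _ _).head fun u => exists_reaches_of_rule hne (.load f q v)
  | branch f q₁ q₂ ih₁ ih₂ =>
    have : Simulates M l₀ v₀ ks (cond (f v) q₁ q₂) v S (TM2.stepAux (branch f q₁ q₂) v S) := by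
      cases hf : f v
      · simpa [hf] using ih₂ v S
      · simpa [hf] using ih₁ v S
    exact this.head fun u => exists_reaches_of_rule hne (.branch f q₁ q₂ v)
  | goto f => exact fun u => exists_reaches_of_rule hne (.goto f v)
  | halt =>
    intro u hu
    cases u with
    | nil =>
      have := hu.perm.length_eq ▸ length_le_length_tape (ks := ks) (S := S)
      exact absurd (length_eq_zero_iff.1 (Nat.le_zero.1 this)) hne
    | cons a u =>
      exact ⟨u, (ReflTransGen.single (.mk (.halt v a))).trans
        (reaches_of_isRotated .fin (isRotated_concat _ _))⟩

lemma Halts.exists_reaches (hks : ks.Nodup) (hall : ∀ k, k ∈ ks) [Nonempty K]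
    (h : Halts M l₀ v₀ S₀) :
    ∃ u, ReflTransGen (QStep M l₀ v₀) (boot, tape ks S₀) (fin, halted :: u) := by
  obtain ⟨v₁, S₁, h⟩ := h
  have key : ∀ c : TM2.Cfg (fun _ : K => G) Λ σ, TM2.Reaches M c ⟨none, v₁, S₁⟩ →
      ∀ l v S u, c = ⟨some l, v, S⟩ → u ~r tape ks S →
        ∃ u', ReflTransGen (QStep M l₀ v₀) (run (M l) v, u) (fin, halted :: u') := by
    intro c hc
    induction hc using ReflTransGen.head_induction_on with
    | refl => rintro l v S u ⟨⟩
    | head h1 h2 ih =>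
      rintro l v S u rfl hu
      obtain rfl := Option.some_injective _ (show some _ = some _ from h1)
      have := simulates_stepAux (M := M) (l₀ := l₀) (v₀ := v₀) hks hall (M l) v S u hu
      revert this ih
      generalize TM2.stepAux (M l) v S = c
      obtain ⟨_ | l', v', S'⟩ := c
      · exact fun _ h => h
      · rintro ih ⟨u', h3, h4⟩
        obtain ⟨u₁, h5⟩ := ih l' v' S' u' rfl h3
        exact ⟨u₁, h4.trans h5⟩
  obtain ⟨a, u, hu⟩ : ∃ a u, tape ks S₀ = a :: u := by
    obtain ⟨k, ks', rfl⟩ := exists_cons_of_ne_nil (ne_nil_of_mem (hall (Classical.arbitrary K)))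
    exact ⟨_, _, tape_cons⟩
  obtain ⟨u', h'⟩ := key _ h l₀ v₀ S₀ (u ++ [a]) rfl (hu ▸ isRotated_concat _ _)
  exact ⟨u', hu ▸ .head (.mk (.boot a)) h'⟩

end QueueSim

end CFSM

namespace CFSM

open Turing Relation

namespace Controller

variable {Γ : Type} (C : Controller Γ)

/-- The controller with the states that satisfy `P`. -/
def restrict (P : C.State → Prop) (h : P C.init) : Controller Γ where
  State := {x // P x}
  init := ⟨C.init, h⟩
  push x a y := C.push x a y
  order x a y := C.order x a y
  next x a y := C.next x a y

variable {C} {P : C.State → Prop} {h : P C.init}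

lemma Reaches.of_restrict {x : (C.restrict P h).State} {u : List Γ}
    (hx : (C.restrict P h).Reaches x u) : C.Reaches x.1 u := by
  induction hx with
  | init => exact .init
  | push _ h1 ih => exact ih.push h1
  | pop _ h1 h2 ih => exact ih.pop h1 h2

lemma Reaches.restrict (hpush : ∀ x a y, P x → C.push x a y → P y)
    (horder : ∀ x a y, P x → C.order x a y → P y) (hnext : ∀ x a y, P x → C.next x a y → P y)
    {x : C.State} {u : List Γ} (hx : C.Reaches x u) :
    ∃ hP : P x, (C.restrict P h).Reaches (⟨x, hP⟩ : {x // P x}) u := by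
  induction hx with
  | init => exact ⟨h, .init⟩
  | push _ h1 ih =>
    obtain ⟨hP, ih⟩ := ih
    exact ⟨hpush _ _ _ hP h1, ih.push h1⟩
  | @pop x a z y u _ h1 h2 ih =>
    obtain ⟨hP, ih⟩ := ih
    have hz := horder _ _ _ hP h1
    exact ⟨hnext _ _ _ hz h2, @Reaches.pop _ (C.restrict P h) ⟨x, hP⟩ a ⟨z, hz⟩ ⟨_, _⟩ u ih h1 h2⟩

lemma KeepsTwo.restrict (hC : C.KeepsTwo) : (C.restrict P h).KeepsTwo :=
  fun _ _ _ _ hx ho => hC _ _ _ _ hx.of_restrict ho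

lemma Waits.restrict (hnext : ∀ x a y, P x → C.next x a y → P y) (hC : C.Waits) :
    (C.restrict P h).Waits := by
  intro x a z ho
  obtain ⟨h1, h2, y, hy⟩ := hC _ _ _ ho
  refine ⟨fun b y => h1 b y.1, fun b y => h2 b y.1,
    ⟨y, hnext _ _ _ z.2 ((hy a y).2 ⟨rfl, rfl⟩)⟩, fun b y' => (hy b y'.1).trans ?_⟩
  exact and_congr_right' ⟨fun e => Subtype.ext e, fun e => congrArg Subtype.val e⟩

lemma dequeues_restrict (hpush : ∀ x a y, P x → C.push x a y → P y)
    (horder : ∀ x a y, P x → C.order x a y → P y) (hnext : ∀ x a y, P x → C.next x a y → P y)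
    {s : Γ} : (C.restrict P h).Dequeues s ↔ C.Dequeues s := by
  constructor
  · rintro ⟨x, u, z, h1, h2⟩
    exact ⟨x.1, u, z.1, h1.of_restrict, h2⟩
  · rintro ⟨x, u, z, h1, h2⟩
    obtain ⟨hP, h1⟩ := h1.restrict (h := h) hpush horder hnext
    exact ⟨_, u, (⟨z, horder _ _ _ hP h2⟩ : {x // P x}), h1, h2⟩

end Controller

namespace QueueSim

open Letter List Ctl

variable {K G Λ σ : Type}

/-! ### The simulation as a controller -/

variable (M : Λ → TM2.Stmt (fun _ : K => G) Λ σ) (l₀ : Λ) (v₀ : σ)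

/-- The controller that executes the rules of the simulation, with the initial queue `w₀`. Its
states are triples of the letter whose removal it waits for, if any, a word that it has to enqueue
(after that removal), and a control state (to be taken after that). -/
def controller (w₀ : List (Letter K G)) : Controller (Letter K G) where
  State := Option (Letter K G) × List (Letter K G) × Ctl K G Λ σ
  init := (none, w₀, boot)
  push x a y := ∃ w s, x = (none, a :: w, s) ∧ y = (none, w, s)
  order x a y := ∃ s w s', Rule M l₀ v₀ s a w s' ∧ x = (none, [], s) ∧ y = (some a, w, s')
  next x a y := ∃ w s, x = (some a, w, s) ∧ y = (none, w, s)

variable {M l₀ v₀} {w₀ : List (Letter K G)}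

lemma controller_waits : (controller M l₀ v₀ w₀).Waits := by
  rintro x a z ⟨s, w, s', -, rfl, rfl⟩
  refine ⟨?_, ?_, (none, w, s'), fun b y => ⟨?_, ?_⟩⟩
  · rintro b y ⟨w, s, ⟨⟩, -⟩
  · rintro b y ⟨s, w, s', -, ⟨⟩, -⟩
  · rintro ⟨w, s, ⟨⟩, rfl⟩
    exact ⟨rfl, rfl⟩
  · rintro ⟨rfl, rfl⟩
    exact ⟨_, _, rfl, rfl⟩

/-- The word that the controller has yet to enqueue belongs to the simulated queue. -/
lemma qstep_of_reaches {x : (controller M l₀ v₀ w₀).State} {u : List (Letter K G)}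
    (h : (controller M l₀ v₀ w₀).Reaches x u) :
    ∃ w s, x = (none, w, s) ∧ ReflTransGen (QStep M l₀ v₀) (boot, w₀) (s, u ++ w) := by
  induction h with
  | init => exact ⟨_, _, rfl, .refl⟩
  | push _ h ih =>
    obtain ⟨w, s, rfl, rfl⟩ := h
    obtain ⟨w', s', h1, h2⟩ := ih
    cases h1
    exact ⟨w, s, rfl, by simpa using h2⟩
  | pop _ h h' ih =>
    obtain ⟨s, w, s', hr, rfl, rfl⟩ := h
    obtain ⟨w'', s'', h1, rfl⟩ := h'
    cases h1
    obtain ⟨w', s', h1, h2⟩ := ih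
    cases h1
    rw [append_nil] at h2
    exact ⟨w, _, rfl, h2.tail (.mk hr)⟩

lemma reaches_append {w : List (Letter K G)} {s : Ctl K G Λ σ} {u : List (Letter K G)}
    (h : (controller M l₀ v₀ w₀).Reaches (none, w, s) u) :
    (controller M l₀ v₀ w₀).Reaches (none, [], s) (u ++ w) := by
  induction w generalizing u with
  | nil => rwa [append_nil]
  | cons a w ih => simpa using ih (h.push ⟨w, s, rfl, rfl⟩)

lemma reaches_of_qstep {x : Ctl K G Λ σ × List (Letter K G)}
    (h : ReflTransGen (QStep M l₀ v₀) (boot, w₀) x) :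
    (controller M l₀ v₀ w₀).Reaches (none, [], x.1) x.2 := by
  induction h with
  | refl => exact reaches_append (u := []) .init
  | tail _ h ih =>
    cases h with
    | mk hr => exact reaches_append (ih.pop ⟨_, _, _, hr, rfl, rfl⟩ ⟨_, _, rfl, rfl⟩)

section

variable [DecidableEq K] {ks : List K} {S₀ : K → List G}

lemma controller_dequeues_iff [Nonempty K] (hks : ks.Nodup) (hall : ∀ k, k ∈ ks) :
    (controller M l₀ v₀ (tape ks S₀)).Dequeues halted ↔ Halts M l₀ v₀ S₀ := by
  constructor
  · rintro ⟨x, u, z, hx, s, w, s', hr, rfl, rfl⟩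
    obtain ⟨w, s, h1, h2⟩ := qstep_of_reaches hx
    cases h1
    rw [append_nil] at h2
    exact (inv_of_reaches hks h2).halts_of_halted hr
  · intro h
    obtain ⟨u, hu⟩ := h.exists_reaches hks hall
    exact ⟨_, u, _, reaches_of_qstep hu, _, _, _, .fin _, rfl, rfl⟩

lemma controller_keepsTwo (hks : ks.Nodup) (h2 : 2 ≤ ks.length) (h : ¬ Halts M l₀ v₀ S₀) :
    (controller M l₀ v₀ (tape ks S₀)).KeepsTwo := by
  rintro x u a z hx ⟨s, w, s', hr, rfl, rfl⟩
  obtain ⟨w, s, h3, h4⟩ := qstep_of_reaches hx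
  cases h3
  rw [append_nil] at h4
  exact (inv_of_reaches hks h4).two_le_length h2 h

end

/-! ### Finitely many states suffice -/

variable (M) in
/-- The control states, apart from `boot`, in which only statements of the labels in `T` occur. -/
def ctlSet (T : Finset Λ) : Set (Ctl K G Λ σ)
  | boot => False
  | run q _ => some q ∈ TM2.stmts M T
  | top q _ => some q ∈ TM2.stmts M T
  | fin => True

variable {T : Finset Λ}

lemma finite_ctlSet [Finite σ] : (ctlSet M T).Finite := by
  have h1 : (Option.some ⁻¹'
      (TM2.stmts M T : Set (Option (TM2.Stmt (fun _ : K => G) Λ σ)))).Finite :=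
    (TM2.stmts M T).finite_toSet.preimage (Option.some_injective _).injOn
  have h2 := h1.prod (Set.finite_univ (α := σ))
  refine (((h2.image fun x => run x.1 x.2).union (h2.image fun x => top x.1 x.2)).union
    (Set.finite_singleton fin)).subset ?_
  rintro (_ | ⟨q, v⟩ | ⟨q, v⟩ | _) hs
  · exact hs.elim
  · exact .inl (.inl ⟨(q, v), ⟨hs, trivial⟩, rfl⟩)
  · exact .inl (.inr ⟨(q, v), ⟨hs, trivial⟩, rfl⟩)
  · exact .inr rfl

lemma run_mem_ctlSet {l : Λ} (hl : l ∈ T) (v : σ) : run (M l) v ∈ ctlSet M T := by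
  change some (M l) ∈ TM2.stmts M T
  classical
  rw [TM2.stmts, Finset.some_mem_insertNone, Finset.mem_biUnion]
  exact ⟨l, hl, TM2.stmts₁_self⟩

/-- The rules do not leave the statements of `T`, and append at most two letters. -/
lemma Rule.mem_ctlSet (hT : ∀ l ∈ T, TM2.SupportsStmt T (M l)) (h₀ : l₀ ∈ T)
    {s s' : Ctl K G Λ σ} {a : Letter K G} {w : List (Letter K G)} (hr : Rule M l₀ v₀ s a w s')
    (hs : s = Ctl.boot ∨ s ∈ ctlSet M T) : s' ∈ ctlSet M T ∧ w.length ≤ 2 := by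
  have self : ∀ q : TM2.Stmt (fun _ : K => G) Λ σ, q ∈ TM2.stmts₁ q := fun q => TM2.stmts₁_self
  have sub : ∀ {q q' : TM2.Stmt (fun _ : K => G) Λ σ}, q' ∈ TM2.stmts₁ q →
      some q ∈ TM2.stmts M T → some q' ∈ TM2.stmts M T := fun h => TM2.stmts_trans h
  refine ⟨?_, by cases hr <;> simp⟩
  rcases hs with rfl | hs
  · cases hr
    exact run_mem_ctlSet h₀ _
  cases hr with
  | boot => exact hs.elim
  | rotate | peek | pop => exact hs
  | push | peekSym | peekMark | popSym | popMark | load =>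
    exact sub (by simp [TM2.stmts₁, self]) hs
  | branch f q₁ q₂ v =>
    refine sub ?_ hs
    cases f v <;> simp [TM2.stmts₁, self]
  | goto f v =>
    let _ : Inhabited Λ := ⟨l₀⟩
    exact run_mem_ctlSet (TM2.stmts_supportsStmt (M := M) ⟨h₀, hT⟩ hs v) _
  | halt => trivial
  | fin => trivial

variable (M) in
/-- A finite set that contains the states of the controller from its first order on. -/
def coreSet (T : Finset Λ) : Set (Option (Letter K G) × List (Letter K G) × Ctl K G Λ σ) :=
  {x | x.2.2 ∈ ctlSet M T ∧ x.2.1.length ≤ 2}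

lemma finite_coreSet [Finite σ] [Finite K] [Finite G] : (coreSet M T).Finite := by
  have h := (Set.finite_univ (α := Option (Letter K G))).prod
    ((List.finite_length_le (Letter K G) 2).prod (finite_ctlSet (M := M) (T := T)))
  exact h.subset fun x hx => ⟨trivial, hx.2, hx.1⟩

/-- The states in which the controller enqueues the initial queue. -/
def IsBoot (w₀ : List (Letter K G)) (x : Option (Letter K G) × List (Letter K G) × Ctl K G Λ σ) :
    Prop :=
  ∃ w, w <:+ w₀ ∧ x = (none, w, boot)

lemma push_mem {x y : (controller M l₀ v₀ w₀).State} {a : Letter K G}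
    (h : (controller M l₀ v₀ w₀).push x a y) :
    (x ∈ coreSet M T → y ∈ coreSet M T) ∧ (IsBoot w₀ x → IsBoot w₀ y) := by
  obtain ⟨w, s, rfl, rfl⟩ := h
  constructor
  · rintro ⟨h1, h2⟩
    exact ⟨h1, (Nat.le_succ _).trans h2⟩
  · rintro ⟨w', h1, ⟨⟩⟩
    exact ⟨w, (suffix_cons a w).trans h1, rfl⟩

lemma order_mem (hT : ∀ l ∈ T, TM2.SupportsStmt T (M l)) (h₀ : l₀ ∈ T)
    {x y : (controller M l₀ v₀ w₀).State} {a : Letter K G}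
    (h : (controller M l₀ v₀ w₀).order x a y) (hx : x ∈ coreSet M T ∨ IsBoot w₀ x) :
    y ∈ coreSet M T := by
  obtain ⟨s, w, s', hr, rfl, rfl⟩ := h
  refine hr.mem_ctlSet hT h₀ ?_
  rcases hx with hx | ⟨w, -, ⟨⟩⟩
  · exact .inr hx.1
  · exact .inl rfl

lemma next_mem {x y : (controller M l₀ v₀ w₀).State} {a : Letter K G}
    (h : (controller M l₀ v₀ w₀).next x a y) (hx : x ∈ coreSet M T ∨ IsBoot w₀ x) :
    y ∈ coreSet M T := by
  obtain ⟨w, s, rfl, rfl⟩ := h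
  rcases hx with hx | ⟨w, -, ⟨⟩⟩
  exact hx

variable (M l₀ v₀ T w₀) in
/-- The controller with finitely many states that executes the rules of the simulation. -/
def finController : Controller (Letter K G) :=
  (controller M l₀ v₀ w₀).restrict (fun x => x ∈ coreSet M T ∨ IsBoot w₀ x)
    (.inr ⟨w₀, suffix_rfl, rfl⟩)

lemma finite_isBoot : {x : Option (Letter K G) × List (Letter K G) × Ctl K G Λ σ |
    IsBoot w₀ x}.Finite := by
  refine ((w₀.tails.finite_toSet).image fun w => (none, w, boot)).subset ?_
  rintro x ⟨w, hw, rfl⟩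
  exact ⟨w, (mem_tails _ _).2 hw, rfl⟩

instance [Finite σ] [Finite K] [Finite G] : Finite (finController M l₀ v₀ w₀ T).State :=
  ((finite_coreSet (M := M) (T := T)).union (finite_isBoot (w₀ := w₀))).to_subtype

lemma finController_waits : (finController M l₀ v₀ w₀ T).Waits :=
  controller_waits.restrict fun _ _ _ hx h => .inl (next_mem h hx)

variable [DecidableEq K] {ks : List K} {S₀ : K → List G}

lemma finController_dequeues_iff [Nonempty K] (hT : ∀ l ∈ T, TM2.SupportsStmt T (M l))
    (h₀ : l₀ ∈ T) (hks : ks.Nodup) (hall : ∀ k, k ∈ ks) :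
    (finController M l₀ v₀ (tape ks S₀) T).Dequeues halted ↔ Halts M l₀ v₀ S₀ := by
  rw [← controller_dequeues_iff hks hall]
  exact Controller.dequeues_restrict
    (fun _ _ _ hx h => hx.imp (push_mem h).1 (push_mem (T := T) h).2)
    (fun _ _ _ hx h => .inl (order_mem hT h₀ h hx)) (fun _ _ _ hx h => .inl (next_mem h hx))

lemma finController_keepsTwo (hks : ks.Nodup) (h2 : 2 ≤ ks.length) (h : ¬ Halts M l₀ v₀ S₀) :
    (finController M l₀ v₀ (tape ks S₀) T).KeepsTwo :=
  (controller_keepsTwo hks h2 h).restrict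

end QueueSim

end CFSM

namespace CFSM

/-! ### Presentations of finite systems -/

/-- `p` presents the automaton with the initial state `q₀` and the transitions `T`, for some
numbering of its states, if the letters are numbered by `f`. -/
def PeerCode.Presents {Q L : Type} (p : PeerCode) (f : L → ℕ) (q₀ : Q)
    (T : Q → Action L → Q → Prop) : Prop :=
  ∃ e : Q ≃ Fin p.numStates, p.init = e q₀ ∧
    ∀ t, t ∈ p.trans ↔ ∃ q α q', T q α q' ∧ t = ((e q).val, α.map f, (e q').val)

lemma exists_list_mem_iff {α : Type} {s : Set α} (hs : s.Finite) :
    ∃ l : List α, ∀ x, x ∈ l ↔ x ∈ s :=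
  ⟨hs.toFinset.toList, fun x => by simp⟩

instance Action.instFinite {L : Type} [Finite L] : Finite (Action L) :=
  Finite.of_equiv _ (Action.equivSum L).symm

lemma exists_presents {Q L : Type} [Finite Q] [Finite L] (f : L → ℕ) (q₀ : Q)
    (T : Q → Action L → Q → Prop) : ∃ p : PeerCode, p.Presents f q₀ T := by
  obtain ⟨n, ⟨e⟩⟩ := Finite.exists_equiv_fin Q
  obtain ⟨l, hl⟩ := exists_list_mem_iff
    ((Set.toFinite {x : Q × Action L × Q | T x.1 x.2.1 x.2.2}).image
      fun x => ((e x.1).val, x.2.1.map f, (e x.2.2).val))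
  refine ⟨⟨n, e q₀, l⟩, e, rfl, fun t => (hl t).trans ?_⟩
  constructor
  · rintro ⟨⟨q, α, q'⟩, h, rfl⟩
    exact ⟨q, α, q', h, rfl⟩
  · rintro ⟨q, α, q', h, rfl⟩
    exact ⟨⟨q, α, q'⟩, h, rfl⟩

/-- The letters of a message set can be listed. -/
lemma MessageSet.exists_messages {n : ℕ} {L : Type} (M : MessageSet n L) :
    ∃ (msgs : List (ℕ × ℕ)) (e : L ≃ Fin msgs.length),
      ∀ a, msgs[e a] = ((M.src a).val, (M.dst a).val) := by
  have := M.finite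
  obtain ⟨n, ⟨e⟩⟩ := Finite.exists_equiv_fin L
  refine ⟨List.ofFn fun i => ((M.src (e.symm i)).val, (M.dst (e.symm i)).val),
    e.trans (finCongr (by simp)), fun a => ?_⟩
  simp

/-- A system of three peers is isomorphic to the one presented by a list of its letters and
presentations of its peers. -/
lemma exists_iso_toSystem {L : Type} {M : MessageSet 3 L} (S : System M) {msgs : List (ℕ × ℕ)}
    (e : L ≃ Fin msgs.length) (he : ∀ a, msgs[e a] = ((M.src a).val, (M.dst a).val))
    (p : Fin 3 → PeerCode)
    (hp : ∀ i, (p i).Presents (fun a => (e a).val) (S.init i) (S.trans i)) :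
    ∃ h : SystemCode.WellFormed ⟨msgs, [p 0, p 1, p 2]⟩,
      Nonempty (System.Iso S (SystemCode.toSystem h)) := by
  choose s hs ht using hp
  have hmem : ∀ i (hi : i < 3), [p 0, p 1, p 2][i] = p ⟨i, hi⟩ := by
    intro i hi
    interval_cases i <;> rfl
  have hpeer : ∀ α : Action L,
      SystemCode.peer? ⟨msgs, [p 0, p 1, p 2]⟩ (α.map fun a => (e a).val) =
        some (M.peer α).val := by
    have h : ∀ a, msgs[(e a).val] = ((M.src a).val, (M.dst a).val) := he
    rintro (a | a) <;> simp [SystemCode.peer?, Action.map, h, MessageSet.peer]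
  have h : SystemCode.WellFormed ⟨msgs, [p 0, p 1, p 2]⟩ := by
    refine ⟨by simp [SystemCode.numPeers], fun m hm => ?_, fun q hq => ?_, fun i hi t hq => ?_⟩
    · obtain ⟨i, hi, rfl⟩ := List.mem_iff_getElem.1 hm
      have := he (e.symm ⟨i, hi⟩)
      simp only [Equiv.apply_symm_apply, Fin.getElem_fin] at this
      rw [this]
      exact ⟨(M.src _).isLt, (M.dst _).isLt, fun h => M.src_ne_dst _ (Fin.ext h)⟩
    · obtain ⟨i, hi, rfl⟩ := List.mem_iff_getElem.1 hq
      rw [hmem i hi, hs]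
      exact (s _ _).isLt
    · simp only [hmem i hi] at hq ⊢
      obtain ⟨q, α, q', h, rfl⟩ := (ht _ _).1 hq
      exact ⟨(s _ _).isLt, (s _ _).isLt, by rw [hpeer, S.peer_eq _ _ _ _ h]⟩
  have hmap : ∀ α : Action L, (α.map e).map Fin.val = α.map fun a => (e a).val := by
    rintro (a | a) <;> rfl
  have key : ∀ (i : Fin 3) (q : S.State i) (α : Action L) (q' : S.State i),
      ((s i q).val, (α.map e).map Fin.val, (s i q').val) ∈ (p i).trans ↔ S.trans i q α q' := by
    intro i q α q'
    rw [hmap, ht]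
    constructor
    · rintro ⟨r, β, r', h, hr⟩
      simp only [Prod.mk.injEq] at hr
      obtain ⟨h1, h2, h3⟩ := hr
      obtain rfl := (s i).injective (Fin.ext h1)
      obtain rfl := (s i).injective (Fin.ext h3)
      suffices α = β by rwa [this]
      cases α <;> cases β <;> simp [Action.map, Fin.val_inj] at h2 ⊢ <;> exact h2
    · intro h
      exact ⟨q, α, q', h, rfl⟩
  refine ⟨h, ⟨{
    letter := e
    state := fun
      | 0 => s 0
      | 1 => s 1
      | 2 => s 2
    src_eq := fun a => Fin.ext (congrArg Prod.fst (he a))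
    dst_eq := fun a => Fin.ext (congrArg Prod.snd (he a))
    init_eq := fun
      | 0 => Fin.ext (hs 0)
      | 1 => Fin.ext (hs 1)
      | 2 => Fin.ext (hs 2)
    trans_iff := fun
      | 0 => key 0
      | 1 => key 1
      | 2 => key 2 }⟩⟩

/-- The transitions that send a word and count down the number of letters to be sent; the states
are numbered from `n` on. -/
def chain (n : ℕ) : List ℕ → List (ℕ × Action ℕ × ℕ)
  | [] => []
  | a :: w => (n + (w.length + 1), .send a, n + w.length) :: chain n w

lemma mem_chain_map {α : Type} {n : ℕ} {f : α → ℕ} {w : List α} {t : ℕ × Action ℕ × ℕ} :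
    t ∈ chain n (w.map f) ↔
      ∃ a v, a :: v <:+ w ∧ t = (n + (v.length + 1), .send (f a), n + v.length) := by
  induction w with
  | nil => simp [chain]
  | cons b w ih =>
    simp only [List.map_cons, chain, List.mem_cons, ih, List.length_map]
    constructor
    · rintro (rfl | ⟨a, v, h, rfl⟩)
      · exact ⟨b, w, List.suffix_rfl, rfl⟩
      · exact ⟨a, v, h.trans (List.suffix_cons _ _), rfl⟩
    · rintro ⟨a, v, h, rfl⟩
      rcases List.suffix_cons_iff.1 h with h | h
      · cases h
        exact .inl rfl
      · exact .inr ⟨a, v, h, rfl⟩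

namespace QueueSim

open Letter List Ctl Turing

variable {K G Λ σ : Type} {M : Λ → TM2.Stmt (fun _ : K => G) Λ σ} {l₀ : Λ} {v₀ : σ} {T : Finset Λ}

/-- The controllers for different initial queues are presented uniformly: only the number of
states, the initial state, and the transitions that enqueue the initial queue differ. -/
lemma exists_presents_finController [Finite K] [Finite G] [Finite σ]
    (hT : ∀ l ∈ T, TM2.SupportsStmt T (M l)) (h₀ : l₀ ∈ T) (f : Msg (Letter K G) → ℕ) :
    ∃ (n : ℕ) (base : List (ℕ × Action ℕ × ℕ)), ∀ w₀ : List (Letter K G),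
      PeerCode.Presents
        ⟨n + (w₀.length + 1), n + w₀.length, base ++ chain n (w₀.map fun a => f (.data a))⟩ f
        (finController M l₀ v₀ w₀ T).init (finController M l₀ v₀ w₀ T).Trans := by
  classical
  have hfin := finite_coreSet (M := M) (T := T)
  have := hfin.to_subtype
  obtain ⟨n, ⟨e⟩⟩ := Finite.exists_equiv_fin (coreSet M T)
  -- The states of `coreSet` come first, then those that enqueue the initial queue, ordered by the
  -- number of letters that remain.
  let num : Option (Letter K G) × List (Letter K G) × Ctl K G Λ σ → ℕ :=
    fun x => if h : x ∈ coreSet M T then (e ⟨x, h⟩).val else n + x.2.1.length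
  have num_core : ∀ x (h : x ∈ coreSet M T), num x = e ⟨x, h⟩ := fun x h => dif_pos h
  have num_boot : ∀ w, num (none, w, boot) = n + w.length := fun w => dif_neg fun h => h.1
  have hfin' := (hfin.union (Set.finite_singleton ((none, [], boot) :
    Option (Letter K G) × List (Letter K G) × Ctl K G Λ σ))).prod
      ((Set.finite_univ (α := Action (Msg (Letter K G)))).prod hfin)
  -- The transitions do not depend on the initial queue, which may therefore be taken empty here.
  obtain ⟨base, hbase⟩ : ∃ base : List (ℕ × Action ℕ × ℕ), ∀ t, t ∈ base ↔ ∃ x α y,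
      (x ∈ coreSet M T ∨ x = (none, [], boot)) ∧ y ∈ coreSet M T ∧
        (controller M l₀ v₀ []).Trans x α y ∧ t = (num x, α.map f, num y) := by
    obtain ⟨base, hbase⟩ := exists_list_mem_iff ((hfin'.subset (Set.sep_subset _
      fun x => (controller M l₀ v₀ []).Trans x.1 x.2.1 x.2.2)).image
        fun x => (num x.1, x.2.1.map f, num x.2.2))
    refine ⟨base, fun t => (hbase t).trans ⟨?_, ?_⟩⟩
    · rintro ⟨⟨x, α, y⟩, ⟨⟨hx, -, hy⟩, h⟩, rfl⟩
      exact ⟨x, α, y, hx, hy, h, rfl⟩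
    · rintro ⟨x, α, y, hx, hy, h, rfl⟩
      exact ⟨(x, α, y), ⟨⟨hx, trivial, hy⟩, h⟩, rfl⟩
  refine ⟨n, base, fun w₀ => ?_⟩
  have hlt : ∀ x : (finController M l₀ v₀ w₀ T).State, num x.1 < n + (w₀.length + 1) := by
    rintro ⟨x, hx | ⟨w, hw, rfl⟩⟩
    · have := (e ⟨x, hx⟩).isLt
      change num x < _
      rw [num_core x hx]
      omega
    · have := hw.length_le
      change num (none, w, boot) < _
      rw [num_boot]
      omega
  have hbij : Function.Bijective fun x : (finController M l₀ v₀ w₀ T).State =>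
      (⟨num x.1, hlt x⟩ : Fin (n + (w₀.length + 1))) := by
    constructor
    · rintro ⟨x, hx | ⟨w, hw, rfl⟩⟩ ⟨y, hy | ⟨w', hw', rfl⟩⟩ hxy
      all_goals
        replace hxy := congrArg Fin.val hxy
        refine Subtype.ext ?_
        simp only at hxy ⊢
      · rw [num_core x hx, num_core y hy] at hxy
        exact congrArg Subtype.val (e.injective (Fin.ext hxy))
      · rw [num_core x hx, num_boot] at hxy
        have := (e ⟨x, hx⟩).isLt
        omega
      · rw [num_core y hy, num_boot] at hxy
        have := (e ⟨y, hy⟩).isLt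
        omega
      · rw [num_boot, num_boot] at hxy
        have hlen : w.length = w'.length := by omega
        rw [(suffix_of_suffix_length_le hw hw' hlen.le).eq_of_length hlen]
    · rintro ⟨m, hm⟩
      by_cases hmn : m < n
      · refine ⟨⟨(e.symm ⟨m, hmn⟩).1, .inl (e.symm ⟨m, hmn⟩).2⟩, Fin.ext ?_⟩
        change num _ = m
        rw [num_core _ (e.symm ⟨m, hmn⟩).2]
        simp
      · refine ⟨⟨(none, w₀.drop (w₀.length - (m - n)), boot), .inr ⟨_, drop_suffix _ _, rfl⟩⟩,
          Fin.ext ?_⟩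
        change num _ = m
        rw [num_boot, length_drop]
        omega
  refine ⟨Equiv.ofBijective _ hbij, (num_boot _).symm, fun t => ?_⟩
  rw [mem_append, hbase, mem_chain_map]
  constructor
  · rintro (⟨x, α, y, hx, hy, h, rfl⟩ | ⟨a, w, hw, rfl⟩)
    · refine ⟨⟨x, hx.imp id fun hx => ⟨[], nil_suffix, hx⟩⟩, α, ⟨y, .inl hy⟩, ?_, rfl⟩
      rcases α with (_ | _ | _ | _ | _) | (_ | _ | _ | _ | _) <;> exact h
    · refine ⟨⟨(none, a :: w, boot), .inr ⟨_, hw, rfl⟩⟩, .send (.data a),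
        ⟨(none, w, boot), .inr ⟨_, (suffix_cons _ _).trans hw, rfl⟩⟩, ⟨w, boot, rfl, rfl⟩, ?_⟩
      change _ = (num (none, a :: w, boot), _, num (none, w, boot))
      rw [num_boot, num_boot]
      rfl
  · rintro ⟨⟨x, hx⟩, α, ⟨y, hy⟩, h, rfl⟩
    rcases α with (a | a | a | a | a) | (a | a | a | a | a)
    case send.data =>
      rcases hx with hx | ⟨w, hw, rfl⟩
      · exact .inl ⟨x, .send (.data a), y, .inl hx, (push_mem h).1 hx, h, rfl⟩
      · obtain ⟨w', s, h1, rfl⟩ := h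
        cases h1
        refine .inr ⟨a, w', hw, ?_⟩
        change (num (none, a :: w', boot), _, num (none, w', boot)) = _
        rw [num_boot, num_boot]
        rfl
    case send.order =>
      refine .inl ⟨x, .send (.order a), y, ?_, order_mem hT h₀ h hx, h, rfl⟩
      refine hx.imp id ?_
      rintro ⟨w, -, rfl⟩
      obtain ⟨s, w', s', -, h1, -⟩ := h
      cases h1
      rfl
    case recv.ack =>
      refine .inl ⟨x, .recv (.ack a), y, ?_, next_mem h hx, h, rfl⟩
      refine hx.imp id ?_
      rintro ⟨w, -, rfl⟩
      obtain ⟨w', s, h1, -⟩ := h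
      cases h1
    all_goals exact h.elim

end QueueSim

end CFSM

namespace CFSM

/-! ### The reduction from the halting problem -/

section Primrec

lemma Action.primrec_send {L : Type} [Primcodable L] :
    Primrec (Action.send : L → Action L) :=
  (Primrec.of_equiv_symm (e := Action.equivSum L)).comp Primrec.sumInl

lemma primrec_chain (n : ℕ) : Primrec (chain n) := by
  have h : Primrec₂ fun (_ : List ℕ) (x : ℕ × List ℕ × List (ℕ × Action ℕ × ℕ)) =>
      (n + (x.2.1.length + 1), Action.send x.1, n + x.2.1.length) :: x.2.2 := by
    have hl : Primrec fun x : List ℕ × ℕ × List ℕ × List (ℕ × Action ℕ × ℕ) => x.2.2.1.length :=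
      Primrec.list_length.comp (Primrec.fst.comp (Primrec.snd.comp Primrec.snd))
    refine Primrec.list_cons.comp₂ (Primrec.pair ?_ (Primrec.pair ?_ ?_)) ?_
    · exact Primrec.nat_add.comp (Primrec.const n) (Primrec.succ.comp hl)
    · exact Action.primrec_send.comp (Primrec.fst.comp Primrec.snd)
    · exact Primrec.nat_add.comp (Primrec.const n) hl
    · exact Primrec.snd.comp (Primrec.snd.comp Primrec.snd)
  refine (Primrec.list_rec Primrec.id (Primrec.const []) h).of_eq fun w => ?_
  induction w with
  | nil => rfl
  | cons a w ih => exact congrArg _ ih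

open Turing PartrecToTM2

lemma trNat_of_ne_zero {n : ℕ} (hn : n ≠ 0) :
    trNat n = (if n % 2 = 0 then Γ'.bit0 else Γ'.bit1) :: trNat (n / 2) := by
  have h : ((Nat.bit n.bodd (n / 2) : ℕ) : Num) =
      cond n.bodd Num.bit1 Num.bit0 ((n / 2 : ℕ) : Num) := Num.ofNat'_bit _ _
  rw [← Nat.div2_val, Nat.bit_bodd_div2, Nat.div2_val] at h
  rw [Nat.mod_two_of_bodd, trNat, trNat]
  have hn' : (n : Num) ≠ 0 := by exact_mod_cast hn
  rw [h] at hn' ⊢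
  revert hn'
  cases n.bodd <;> cases ((n / 2 : ℕ) : Num) <;> intro hn' <;>
    first | rfl | exact (hn' rfl).elim

lemma primrec_map_trNat (f : Γ' → ℕ) : Primrec fun n => (trNat n).map f := by
  have hg : Primrec₂ fun (_ : Unit) (l : List (List ℕ)) =>
      if l.length = 0 then some [] else
        l[l.length / 2]?.map
          (List.cons (if l.length % 2 = 0 then f Γ'.bit0 else f Γ'.bit1)) := by
    have hl : Primrec fun x : Unit × List (List ℕ) => x.2.length :=
      Primrec.list_length.comp Primrec.snd
    have two : Primrec fun _ : Unit × List (List ℕ) => 2 := Primrec.const 2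
    refine Primrec.ite (Primrec.eq.comp hl (Primrec.const 0)) (Primrec.const _)
      (Primrec.option_map (Primrec.list_getElem?.comp Primrec.snd (Primrec.nat_div.comp hl two)) ?_)
    have hbit : Primrec fun x : Unit × List (List ℕ) =>
        if x.2.length % 2 = 0 then f Γ'.bit0 else f Γ'.bit1 :=
      Primrec.ite (Primrec.eq.comp (Primrec.nat_mod.comp hl two) (Primrec.const 0))
        (Primrec.const _) (Primrec.const _)
    exact Primrec.list_cons.comp (hbit.comp Primrec.fst) Primrec.snd
  refine (Primrec.nat_strong_rec (fun (_ : Unit) n => (trNat n).map f) hg fun _ n => ?_).comp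
    (Primrec.const ()) Primrec.id
  rcases eq_or_ne n 0 with rfl | hn
  · simp
  · have h : n / 2 < n := Nat.div_lt_self (Nat.pos_of_ne_zero hn) one_lt_two
    rw [trNat_of_ne_zero hn]
    simp [hn, h, apply_ite f]

end Primrec

open Turing PartrecToTM2 QueueSim

instance : Finite K' :=
  Finite.of_surjective ![K'.main, K'.rev, K'.aux, K'.stack] fun k => by
    cases k
    exacts [⟨0, rfl⟩, ⟨1, rfl⟩, ⟨2, rfl⟩, ⟨3, rfl⟩]

instance : Nonempty K' := ⟨K'.main⟩

/-- The program `PartrecToTM2.tr`, with its type `Stmt'` of statements unfolded. -/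
def prog : Λ' → TM2.Stmt (fun _ : K' => Γ') Λ' (Option Γ') := tr

/-- The machine of `PartrecToTM2` halts exactly where the code that it executes is defined. -/
lemma halts_iff_dom (c : ToPartrec.Code) (v : List ℕ) :
    Halts prog (trNormal c Cont'.halt) none (K'.elim (trList v) [] [] []) ↔ (c.eval v).Dom := by
  have h : (StateTransition.eval (TM2.step prog) (init c v)).Dom ↔ (c.eval v).Dom :=
    iff_of_eq (congrArg Part.Dom (tr_eval c v))
  refine Iff.trans ?_ (Part.dom_iff_mem.symm.trans h)
  refine Iff.trans ?_ (exists_congr fun _ => StateTransition.mem_eval.symm)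
  constructor
  · rintro ⟨v, S, h⟩
    exact ⟨_, h, rfl⟩
  · rintro ⟨⟨_ | l, v, S⟩, h1, h2⟩
    · exact ⟨v, S, h1⟩
    · cases h2

/-- Halting is reducible to synchronizability and to language synchronizability of systems with
three peers at once. -/
lemma exists_reduction : ∃ F : Nat.Partrec.Code → SystemCode, Computable F ∧
    ∀ c, ∃ h : (F c).WellFormed, (F c).numPeers = 3 ∧
      ((c.eval 0).Dom → ¬ (SystemCode.toSystem h).LanguageSynchronizable) ∧
      (¬ (c.eval 0).Dom → (SystemCode.toSystem h).Synchronizable) := by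
  have hpart : Partrec fun n : ℕ => (Denumerable.ofNat Nat.Partrec.Code n).eval 0 :=
    Nat.Partrec.Code.eval_part.comp (Computable.ofNat _) (Computable.const 0)
  obtain ⟨c, hc⟩ := ToPartrec.Code.exists_code (Nat.Partrec'.part_iff₁.2 hpart)
  -- A machine with stacks that runs the code given as its input.
  let l₀ := trNormal c Cont'.halt
  let T := codeSupp c Cont'.halt
  have hT : ∀ l ∈ T, TM2.SupportsStmt T (prog l) := (tr_supports c Cont'.halt).2
  have h₀ : l₀ ∈ T := (tr_supports c Cont'.halt).1
  let ks : List K' := [.main, .rev, .aux, .stack]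
  have hks : ks.Nodup := by decide
  have hall : ∀ k, k ∈ ks := by
    intro k
    cases k <;> decide
  obtain ⟨msgs, e, he⟩ := (Msg.messageSet (Letter K' Γ')).exists_messages
  let num := fun a => (e a).val
  obtain ⟨n, base, hp0⟩ := exists_presents_finController (v₀ := none) hT h₀ num
  obtain ⟨p1, hp1⟩ := exists_presents num Checker.honest
    (Checker.Trans (Letter.halted : Letter K' Γ'))
  obtain ⟨p2, hp2⟩ := exists_presents num none (Forward (Γ := Letter K' Γ'))
  let S₀ : ℕ → K' → List Γ' := fun m => K'.elim (trList [m]) [] [] []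
  let w : ℕ → List ℕ := fun m => (tape ks (S₀ m)).map fun a => num (.data a)
  have hw : Primrec w := by
    have h : Primrec fun m => num (.data (.mark .main)) ::
        ((trNat m).map (fun x => num (.data (.sym x))) ++ [num (.data (.sym .cons)),
          num (.data (.mark .rev)), num (.data (.mark .aux)), num (.data (.mark .stack))]) :=
      Primrec.list_cons.comp (Primrec.const _)
        (Primrec.list_append.comp (primrec_map_trNat _) (Primrec.const _))
    refine h.of_eq fun m => ?_
    simp [w, tape, ks, S₀]
  let p0 : ℕ → PeerCode := fun m =>
    ⟨n + ((w m).length + 1), n + (w m).length, base ++ chain n (w m)⟩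
  have hlen := Primrec.list_length.comp hw
  have hp : Primrec p0 := (Primrec.of_equiv_symm (e := PeerCode.equivProd)).comp
    (Primrec.pair (Primrec.nat_add.comp (Primrec.const n) (Primrec.succ.comp hlen))
      (Primrec.pair (Primrec.nat_add.comp (Primrec.const n) hlen)
        (Primrec.list_append.comp (Primrec.const base) ((primrec_chain n).comp hw))))
  have hF : Primrec fun m => (⟨msgs, [p0 m, p1, p2]⟩ : SystemCode) :=
    (Primrec.of_equiv_symm (e := SystemCode.equivProd)).comp
      (Primrec.pair (Primrec.const msgs) (Primrec.list_cons.comp hp (Primrec.const _)))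
  refine ⟨_, (hF.comp Primrec.encode).to_comp, fun d => ?_⟩
  set m := Encodable.encode d
  let C := finController prog l₀ none (tape ks (S₀ m)) T
  obtain ⟨h, ⟨i⟩⟩ := exists_iso_toSystem (C.system .halted) e he ![p0 m, p1, p2] (by
    intro i
    match i with
    | 0 =>
      have h := hp0 (tape ks (S₀ m))
      rw [← List.length_map (f := fun a => num (.data a))] at h
      exact h
    | 1 => exact hp1
    | 2 => exact hp2)
  have hdom : (d.eval 0).Dom ↔ Halts prog l₀ none (S₀ m) := by
    have hm : c.eval [m] = pure <$> d.eval 0 := by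
      have h := hc ⟨[m], rfl⟩
      change c.eval [m] = pure <$> (Denumerable.ofNat Nat.Partrec.Code m).eval 0 at h
      rwa [Denumerable.ofNat_encode] at h
    rw [halts_iff_dom, hm]
    rfl
  refine ⟨h, rfl, fun hd => ?_, fun hd => ?_⟩
  · exact (i.hasAsyncSend (Controller.hasAsyncSend finController_waits
      ((finController_dequeues_iff hT h₀ hks hall).2 (hdom.1 hd)))).not_languageSynchronizable
  · rw [hdom] at hd
    exact (i.hasSyncRuns (Controller.hasSyncRuns finController_waits
      (finController_keepsTwo hks (by decide) hd)
      fun h => hd ((finController_dequeues_iff hT h₀ hks hall).1 h))).synchronizable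

/-- No computable function decides, on systems with three peers, a property that lies between
synchronizability and language synchronizability. -/
lemma not_computable_of_between (P : ∀ c : SystemCode, c.WellFormed → Prop)
    (h1 : ∀ c h, (SystemCode.toSystem (c := c) h).Synchronizable → P c h)
    (h2 : ∀ c h, P c h → (SystemCode.toSystem (c := c) h).LanguageSynchronizable) :
    ¬ ∃ f : SystemCode → Bool, Computable f ∧
      ∀ (c : SystemCode) (h : c.WellFormed), c.numPeers = 3 → (f c = true ↔ P c h) := by
  rintro ⟨f, hf, hfP⟩
  obtain ⟨F, hF, h⟩ := exists_reduction
  refine ComputablePred.halting_problem 0 (ComputablePred.computable_iff.2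
    ⟨fun c => !f (F c), Primrec.not.to_comp.comp (hf.comp hF), funext fun c => propext ?_⟩)
  obtain ⟨hw, h3, hd, hn⟩ := h c
  have := hfP _ hw h3
  by_cases hdom : (c.eval 0).Dom
  · have : ¬ f (F c) = true := fun h => hd hdom (h2 _ _ (this.1 h))
    simp [hdom, this]
  · have : f (F c) = true := this.2 (h1 _ _ (hn hdom))
    simp [hdom, this]

end CFSM

theorem mainTheorem1 :
    -- no algorithm decides synchronizability of arbitrary systems
    (¬ ∃ f : CFSM.SystemCode → Bool, Computable f ∧
      ∀ (c : CFSM.SystemCode) (h : c.WellFormed),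
        f c = true ↔ (CFSM.SystemCode.toSystem h).Synchronizable) ∧
    -- no algorithm decides language synchronizability of arbitrary systems
    (¬ ∃ f : CFSM.SystemCode → Bool, Computable f ∧
      ∀ (c : CFSM.SystemCode) (h : c.WellFormed),
        f c = true ↔ (CFSM.SystemCode.toSystem h).LanguageSynchronizable) ∧
    -- no algorithm decides synchronizability correctly on all systems with three peers
    (¬ ∃ f : CFSM.SystemCode → Bool, Computable f ∧
      ∀ (c : CFSM.SystemCode) (h : c.WellFormed), c.numPeers = 3 →
        (f c = true ↔ (CFSM.SystemCode.toSystem h).Synchronizable)) ∧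
    -- no algorithm decides language synchronizability correctly on all systems with three peers
    (¬ ∃ f : CFSM.SystemCode → Bool, Computable f ∧
      ∀ (c : CFSM.SystemCode) (h : c.WellFormed), c.numPeers = 3 →
        (f c = true ↔ (CFSM.SystemCode.toSystem h).LanguageSynchronizable)) := by
  have key := CFSM.not_computable_of_between
  refine ⟨fun ⟨f, hf, h⟩ => ?_, fun ⟨f, hf, h⟩ => ?_, ?_, ?_⟩
  · exact key _ (fun _ _ h => h) (fun _ _ h => h.languageSynchronizable)
      ⟨f, hf, fun c hc _ => h c hc⟩
  · exact key _ (fun _ _ h => h.languageSynchronizable) (fun _ _ h => h)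
      ⟨f, hf, fun c hc _ => h c hc⟩
  · exact key _ (fun _ _ h => h) (fun _ _ h => h.languageSynchronizable)
  · exact key _ (fun _ _ h => h.languageSynchronizable) (fun _ _ h => h)
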